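/- Let $G$ be a countable group with identity $e$, and let $\mu$ be a probability measure on $G$ whose support generates $G$. Let $X_1,X_2,\dots$ be the coordinates on the product space $(G^{\mathbb N},\mathbb P=\mu^{\mathbb N})$, so that they are i.i.d. with law $\mu$, and let $S_0=e$, $S_n=S_{n-1}X_n$ for $n\ge 1$. For a discrete random element $Y$ write $H(Y)=-\sum_y\mathbb P(Y=y)\ln\mathbb P(Y=y)$ (with $0\ln 0=0$) for its Shannon entropy, and assume $0<H(X_1)<\infty$. Let $\Gamma_n=(R_n,\overrightarrow{E}_n,W_n)$ be the random weighted digraph generated by the first $n$ steps, that is, $R_n=\{S_0,\dots,S_n\}$, $\overrightarrow{E}_n=\{(S_i,S_{i+1}):0\le i<n\}$, and $W_n(x,y)=\#\{0\le i<n: S_i=x,\ S_{i+1}=y\}$ for $(x,y)\in\overrightarrow{E}_n$. Then the limit $$h_\Gamma(\mu)=\lim_{n\to\infty}\frac{H(\Gamma_n)}{n}$$ exists and is finite, and the random walk $S$ is recurrent, i.e. $\mathbb P(\exists\, n\ge 1:\ S_n=e)=1$, if and only if $h_\Gamma(\mu)=0$. -/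

import Mathlib

open MeasureTheory Filter Topology
open scoped ENNReal NNReal

namespace RandomWalkTrace

/-- The Shannon entropy `H(Y) = -∑_y ℙ(Y = y) ln ℙ(Y = y)` (with `0 ln 0 = 0`) of a discrete
random element `Y`, as an element of `[0, ∞]`. -/
noncomputable def entropy {Ω : Type*} [MeasurableSpace Ω] (P : Measure Ω) {α : Type*}
    (Y : Ω → α) : ℝ≥0∞ :=
  ∑' y : α, ENNReal.ofReal (Real.negMulLog (P.real {ω | Y ω = y}))

/-- The law `μ^ℕ` of the increments, on the infinite product space `G^ℕ`. -/
noncomputable def pathMeasure {G : Type*} [MeasurableSpace G] (μ : Measure G) :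
    Measure (ℕ → G) :=
  Measure.infinitePi (fun _ : ℕ => μ)

/-- The `n`-th increment `X_n` of the walk, for `n ≥ 1`: the increments are indexed by
`1, 2, …` and the coordinates of `ω` by `0, 1, …`, so `X_{n+1}(ω) = ω n`. -/
def increment {G : Type*} (n : ℕ) (ω : ℕ → G) : G := ω (n - 1)

/-- The random walk `S_0 = e`, `S_{n+1} = S_n X_{n+1}`. -/
def walk {G : Type*} [Group G] (ω : ℕ → G) : ℕ → G
  | 0 => 1
  | n + 1 => walk ω n * increment (n + 1) ω

/-- A weighted digraph with vertices in `V`: a vertex set, a set of directed edges (loops allowed)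
between vertices, and a weight in `ℕ` for each edge; the weight function is extended by `0` to the
pairs that are not edges. -/
@[ext]
structure WeightedDigraph (V : Type*) where
  verts : Set V
  edges : Set (V × V)
  weight : V × V → ℕ
  mem_verts : ∀ a ∈ edges, a.1 ∈ verts ∧ a.2 ∈ verts
  weight_eq_zero : ∀ a, a ∉ edges → weight a = 0

open Classical in
/-- The random weighted digraph `Γ_n` generated by the first `n` steps of the walk: its vertices
are the sites visited up to time `n`, its edges the jumps made up to time `n`, and the weight of an
edge is the number of jumps along it up to time `n`. -/
noncomputable def trace {G : Type*} [Group G] (n : ℕ) (ω : ℕ → G) : WeightedDigraph G where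
  verts := {g | ∃ i ≤ n, walk ω i = g}
  edges := {a | ∃ i < n, walk ω i = a.1 ∧ walk ω (i + 1) = a.2}
  weight a := ∑ i ∈ Finset.range n, if walk ω i = a.1 ∧ walk ω (i + 1) = a.2 then 1 else 0
  mem_verts := by
    rintro a ⟨i, hi, h1, h2⟩
    exact ⟨⟨i, hi.le, h1⟩, ⟨i + 1, hi, h2⟩⟩
  weight_eq_zero := by
    intro a ha
    refine Finset.sum_eq_zero fun i hi => if_neg fun h => ha ⟨i, Finset.mem_range.mp hi, h⟩

/-- The `(G, μ)`-random walk is recurrent: almost surely it returns to the identity. -/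
def IsRecurrent {G : Type*} [Group G] [MeasurableSpace G] (μ : Measure G) : Prop :=
  ∀ᵐ ω ∂(pathMeasure μ), ∃ n : ℕ, 1 ≤ n ∧ walk ω n = 1

end RandomWalkTrace

/-!
Write `X₁` for the first increment and `Wₙ` for the multiset of edges `(Sᵢ, Sᵢ₊₁)`, `i < n`. The
digraph `Γₙ` and `Wₙ` determine each other (`trace_eq`, `digraphOfMultiset_injective`), so that
`H(Γₙ) = H(Wₙ)`. Given `X₁ = x`, the multiset `Wₙ₊₁` is an injective image of the multiset of the
shifted walk, which is independent of `X₁` and has the law of `Wₙ`; hence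
`H(Wₙ₊₁) - H(Wₙ) = H(X₁) - H(X₁ | Wₙ₊₁)` (`entropy_edgeMultiset_succ`). For `n ≥ 1` the conditional
entropies increase with `n`: the multiset `Wₙ` determines `Sₙ`, so `Wₙ₊₁` is a function of
`Wₙ` and of `Xₙ₊₁`, and `Xₙ₊₁` is independent of `(X₁, Wₙ)` (`eventCondEntropy_edgeMultiset_le_succ`). By Cesàro averaging
`H(Γₙ) / n` tends to `h = H(X₁) - supₙ H(X₁ | Wₙ)`, and it remains to compare the
supremum with `H(X₁)`.

*Transience.* Some `x` has `ℙ(X₁ = x, no return) > 0`, and `μ {x} < 1` since `H(X₁) > 0`. If the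
walk has not returned, the only edge of `Wₙ` out of the identity is `(1, X₁)`, so `Wₙ` reveals
`X₁` on an event of probability bounded below, and strict concavity of `t ↦ -t log t` keeps
`H(X₁ | Wₙ)` away from `H(X₁)` (`exists_iSup_condEntropy_lt`).

*Recurrence.* The loops of the walk at the identity can be rotated without changing their edges.
Hence, conditionally on `Wₙ` and on `k` returns before time `n`, the probability of `X₁ = x` is
the expected proportion of steps `x` among the steps taken at the first `k` visits to the identity
(`natCast_mul_measure_hasReturned`). A second moment bound for martingale differences shows that
this proportion is within `O(k ^ (-1/2))` of `μ {x}` (`integral_exitDeviation_sq_le`). As a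
recurrent walk returns `k` times for every `k`, the conditional law of `X₁` given `Wₙ` approaches
`μ`, so the supremum is `H(X₁)` (`entropy_le_iSup_condEntropy`).
-/

namespace RandomWalkTrace

/-! ### Entropy and conditional entropy of discrete random elements -/

/-- The function `b φ(a / b)`, where `φ(t) = -t log t`. For `a = ℙ(A ∩ B)` and `b = ℙ(B)` it is
the contribution of the event `A`, given `B`, to a conditional entropy. The arguments are meant
to be finite with `a ≤ b`; then `φ(a / b) ≥ 0` and nothing is truncated. -/
noncomputable def condTerm (a b : ℝ≥0∞) : ℝ≥0∞ :=
  ENNReal.ofReal (b.toReal * Real.negMulLog (a.toReal / b.toReal))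

/-- The function `φ(a) = -a log a` for a probability `a`. -/
noncomputable def eta (a : ℝ≥0∞) : ℝ≥0∞ := ENNReal.ofReal (Real.negMulLog a.toReal)

lemma condTerm_one (a : ℝ≥0∞) : condTerm a 1 = eta a := by simp [condTerm, eta]

lemma eta_zero : eta 0 = 0 := by simp [eta]

lemma condTerm_zero_left (b : ℝ≥0∞) : condTerm 0 b = 0 := by simp [condTerm]

lemma condTerm_self (a : ℝ≥0∞) : condTerm a a = 0 := by
  rcases eq_or_ne a.toReal 0 with h | h <;> simp [condTerm, h]

lemma condTerm_mul_right (a b : ℝ≥0∞) {c : ℝ≥0∞} (hc : c ≠ ∞) :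
    condTerm (a * c) (b * c) = condTerm a b * c := by
  rcases eq_or_ne c 0 with rfl | h0
  · simp [condTerm]
  have hc' : c.toReal ≠ 0 := ENNReal.toReal_ne_zero.2 ⟨h0, hc⟩
  conv_rhs => rw [← ENNReal.ofReal_toReal hc]
  rw [condTerm, condTerm, ← ENNReal.ofReal_mul' ENNReal.toReal_nonneg, ENNReal.toReal_mul,
    ENNReal.toReal_mul, mul_div_mul_right _ _ hc']
  ring_nf

/-- The tangent line of `φ(t) = -t log t` at `s`, in the form `φ(t) + t ≤ -t log s + s` with `t
= a / b`; the term `a` on the left avoids a subtraction in `ℝ≥0∞`. -/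
lemma condTerm_add_le {a b : ℝ≥0∞} (hab : a ≤ b) (hb : b ≠ ∞) {s : ℝ} (hs : 0 < s) (hs1 : s ≤ 1) :
    condTerm a b + a ≤ a * ENNReal.ofReal (-Real.log s) + b * ENNReal.ofReal s := by
  have ha : a ≠ ∞ := ne_top_of_le_ne_top hb hab
  lift a to ℝ≥0 using ha
  lift b to ℝ≥0 using hb
  have hab' : a ≤ b := by exact_mod_cast hab
  have hl : 0 ≤ -Real.log s := by linarith [Real.log_nonpos hs.le hs1]
  have key : (b : ℝ) * Real.negMulLog (a / b) + a ≤ a * (-Real.log s) + b * s := by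
    rcases eq_zero_or_pos a with rfl | h
    · simp; positivity
    have hb' : (0 : ℝ) < b := by exact_mod_cast h.trans_le hab'
    have ha' : (0 : ℝ) < a := by exact_mod_cast h
    have h1 := Real.log_le_sub_one_of_pos (show 0 < s * b / a by positivity)
    rw [Real.log_div (by positivity) ha'.ne', Real.log_mul hs.ne' hb'.ne'] at h1
    rw [Real.negMulLog, Real.log_div ha'.ne' hb'.ne']
    have h2 := mul_le_mul_of_nonneg_left h1 ha'.le
    have h3 : (b : ℝ) * (-(a / b) * (Real.log a - Real.log b)) =
        -a * (Real.log a - Real.log b) := by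
      field_simp
    have h4 : (a : ℝ) * (s * b / a - 1) = s * b - a := by field_simp
    rw [h3]; rw [h4] at h2; nlinarith
  have h0 : 0 ≤ (b : ℝ) * Real.negMulLog (a / b) :=
    mul_nonneg b.2 (Real.negMulLog_nonneg (by positivity)
      (div_le_one_of_le₀ (by exact_mod_cast hab') b.2))
  calc condTerm a b + a = ENNReal.ofReal ((b : ℝ) * Real.negMulLog (a / b) + a) := by
        rw [ENNReal.ofReal_add h0 a.coe_nonneg]; simp [condTerm]
    _ ≤ ENNReal.ofReal (a * (-Real.log s) + b * s) := ENNReal.ofReal_le_ofReal key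
    _ = _ := by
        rw [ENNReal.ofReal_add (by positivity) (by positivity), ENNReal.ofReal_mul a.coe_nonneg,
          ENNReal.ofReal_mul b.coe_nonneg]
        simp

lemma condTerm_eq_mul_log {a b : ℝ≥0∞} (ha : a ≠ 0) (hab : a ≤ b) (hb : b ≠ ∞) :
    condTerm a b = a * ENNReal.ofReal (-Real.log (a.toReal / b.toReal)) := by
  have ha' : a ≠ ∞ := ne_top_of_le_ne_top hb hab
  have h1 : 0 < a.toReal := ENNReal.toReal_pos ha ha'
  have h2 : 0 < b.toReal := h1.trans_le (ENNReal.toReal_mono hb hab)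
  conv_rhs => rw [← ENNReal.ofReal_toReal ha', ENNReal.toReal_ofReal h1.le]
  rw [condTerm, ← ENNReal.ofReal_mul h1.le, Real.negMulLog]
  congr 1
  field_simp

/-- The log sum inequality: `(a, b) ↦ b φ(a / b)` is countably superadditive. -/
lemma tsum_condTerm_le {α : Type*} {a b : α → ℝ≥0∞} (hab : ∀ i, a i ≤ b i) (hb : ∑' i, b i ≠ ∞) :
    ∑' i, condTerm (a i) (b i) ≤ condTerm (∑' i, a i) (∑' i, b i) := by
  have hAB : ∑' i, a i ≤ ∑' i, b i := ENNReal.tsum_le_tsum hab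
  have hA : ∑' i, a i ≠ ∞ := ne_top_of_le_ne_top hb hAB
  by_cases h0 : ∑' i, a i = 0
  · have : ∀ i, a i = 0 := ENNReal.tsum_eq_zero.1 h0
    simp [this, condTerm_zero_left]
  have hApos := ENNReal.toReal_pos h0 hA
  have hBpos : 0 < (∑' i, b i).toReal := hApos.trans_le (ENNReal.toReal_mono hb hAB)
  set s := (∑' i, a i).toReal / (∑' i, b i).toReal with hs
  have hs0 : 0 < s := by positivity
  have hs1 : s ≤ 1 := div_le_one_of_le₀ (ENNReal.toReal_mono hb hAB) hBpos.le
  rw [condTerm_eq_mul_log h0 hAB hb]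
  refine (ENNReal.add_le_add_iff_right hA).1 ?_
  calc ∑' i, condTerm (a i) (b i) + ∑' i, a i = ∑' i, (condTerm (a i) (b i) + a i) :=
        ENNReal.tsum_add.symm
    _ ≤ ∑' i, (a i * ENNReal.ofReal (-Real.log s) + b i * ENNReal.ofReal s) :=
        ENNReal.tsum_le_tsum fun i => condTerm_add_le (hab i) (ENNReal.ne_top_of_tsum_ne_top hb i)
          hs0 hs1
    _ = (∑' i, a i) * ENNReal.ofReal (-Real.log s) + (∑' i, b i) * ENNReal.ofReal s := by
        rw [ENNReal.tsum_add, ENNReal.tsum_mul_right, ENNReal.tsum_mul_right]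
    _ = _ := by
        congr 1
        conv_lhs => rw [← ENNReal.ofReal_toReal hb]
        rw [← ENNReal.ofReal_mul hBpos.le, hs, mul_div_cancel₀ _ hBpos.ne',
          ENNReal.ofReal_toReal hA]

/-- Splitting an event of probability `b` into pieces of probabilities `p x`: the chain rule for
entropy, one value of the conditioning variable at a time. -/
lemma tsum_eta_eq {α : Type*} {p : α → ℝ≥0∞} {b : ℝ≥0∞} (hp : ∑' x, p x = b) (hb : b ≤ 1) :
    ∑' x, eta (p x) = ∑' x, condTerm (p x) b + eta b := by
  have hbt : b ≠ ∞ := ne_top_of_le_ne_top ENNReal.one_ne_top hb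
  have hle : ∀ x, p x ≤ b := fun x => hp ▸ ENNReal.le_tsum x
  rcases eq_or_ne b 0 with rfl | h0
  · have : ∀ x, p x = 0 := fun x => le_antisymm (hle x) bot_le
    simp [this, condTerm_zero_left, eta_zero]
  have hb0 := ENNReal.toReal_pos h0 hbt
  have hb1 : b.toReal ≤ 1 := by simpa using ENNReal.toReal_mono ENNReal.one_ne_top hb
  have key : ∀ x, eta (p x) = condTerm (p x) b + p x * (b⁻¹ * eta b) := by
    intro x
    have hx1 : (p x).toReal ≤ b.toReal := ENNReal.toReal_mono hbt (hle x)
    have hx0 : 0 ≤ (p x).toReal := ENNReal.toReal_nonneg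
    have e1 : p x * (b⁻¹ * eta b) =
        ENNReal.ofReal ((p x).toReal / b.toReal * Real.negMulLog b.toReal) := by
      rw [ENNReal.ofReal_mul (by positivity), ENNReal.ofReal_div_of_pos hb0,
        ENNReal.ofReal_toReal hbt, ENNReal.ofReal_toReal (ne_top_of_le_ne_top hbt (hle x)),
        ENNReal.div_eq_inv_mul, eta]
      ring
    rw [e1, condTerm, ← ENNReal.ofReal_add, eta]
    · congr 1
      conv_lhs => rw [show (p x).toReal = (p x).toReal / b.toReal * b.toReal by field_simp]
      rw [Real.negMulLog_mul]
    · exact mul_nonneg hb0.le (Real.negMulLog_nonneg (by positivity)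
        (div_le_one_of_le₀ hx1 hb0.le))
    · exact mul_nonneg (by positivity) (Real.negMulLog_nonneg hb0.le hb1)
  simp_rw [key]
  rw [ENNReal.tsum_add, ENNReal.tsum_mul_right, hp, ← mul_assoc, ENNReal.mul_inv_cancel h0 hbt,
    one_mul]

section Random

variable {Ω : Type*} [MeasurableSpace Ω] (P : Measure Ω) {α β ι : Type*}

/-- The contribution `E[φ(ℙ(B | Y))]` of the event `B` to a conditional entropy given `Y`, where
`φ(t) = -t log t`. -/
noncomputable def eventCondEntropy (B : Set Ω) (Y : Ω → α) : ℝ≥0∞ :=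
  ∑' y, condTerm (P (B ∩ {ω | Y ω = y})) (P {ω | Y ω = y})

/-- The conditional Shannon entropy `H(X | Y)`. -/
noncomputable def condEntropy (X : Ω → ι) (Y : Ω → α) : ℝ≥0∞ :=
  ∑' x, eventCondEntropy P {ω | X ω = x} Y

lemma entropy_eq (Y : Ω → α) : entropy P Y = ∑' y, eta (P {ω | Y ω = y}) := rfl

lemma entropy_comp_injective {f : α → β} (hf : f.Injective) (Y : Ω → α) :
    entropy P (fun ω => f (Y ω)) = entropy P Y := by
  rw [entropy_eq, entropy_eq, ← hf.tsum_eq]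
  · simp [hf.eq_iff]
  · intro b hb
    by_contra h
    refine hb ?_
    have : {ω | f (Y ω) = b} = ∅ := by
      ext ω
      simp only [Set.mem_ofPred_eq, Set.mem_empty_iff_false, iff_false]
      exact fun e => h ⟨_, e⟩
    simp [this, eta]

variable {P}

lemma tsum_measure_inter_fiber [Countable α] {Y : Ω → α} (hY : ∀ y, MeasurableSet {ω | Y ω = y})
    (B : Set Ω) : ∑' y, P (B ∩ {ω | Y ω = y}) = P B := by
  have := measure_iUnion (μ := P.restrict B) (f := fun y => {ω | Y ω = y})
    (fun y z h => Set.disjoint_left.2 fun ω h1 h2 => h (h1.symm.trans h2)) hY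
  rw [show (⋃ y, {ω | Y ω = y}) = Set.univ by ext; simp, Measure.restrict_apply_univ] at this
  rw [this]
  exact tsum_congr fun y => by rw [Measure.restrict_apply (hY y), Set.inter_comm]

/-- Conditioning on less information increases the conditional entropy. -/
lemma eventCondEntropy_le_comp [IsFiniteMeasure P] [Countable α] {Y : Ω → α}
    (hY : ∀ y, MeasurableSet {ω | Y ω = y}) (B : Set Ω) (f : α → β) :
    eventCondEntropy P B Y ≤ eventCondEntropy P B (fun ω => f (Y ω)) := by
  have fib : ∀ (C : Set Ω) (b : β), ∑' y : f ⁻¹' {b}, P (C ∩ {ω | Y ω = y}) =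
      P (C ∩ {ω | f (Y ω) = b}) := by
    intro C b
    rw [← tsum_measure_inter_fiber hY (C ∩ {ω | f (Y ω) = b}),
      tsum_subtype (f ⁻¹' {b}) (fun y => P (C ∩ {ω | Y ω = y}))]
    refine tsum_congr fun y => ?_
    by_cases h : f y = b
    · rw [Set.indicator_of_mem (by simpa using h)]
      congr 1
      ext ω
      simp only [Set.mem_inter_iff, Set.mem_ofPred_eq]
      constructor
      · rintro ⟨h1, rfl⟩; exact ⟨⟨h1, h⟩, rfl⟩
      · rintro ⟨⟨h1, _⟩, rfl⟩; exact ⟨h1, rfl⟩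
    · rw [Set.indicator_of_notMem (by simpa using h)]
      symm
      convert measure_empty (μ := P)
      ext ω
      simp only [Set.mem_inter_iff, Set.mem_ofPred_eq, Set.mem_empty_iff_false, iff_false]
      rintro ⟨⟨_, h2⟩, rfl⟩; exact h h2
  have fib' : ∀ b : β, ∑' y : f ⁻¹' {b}, P {ω | Y ω = y} = P {ω | f (Y ω) = b} := fun b => by
    simpa using fib Set.univ b
  rw [eventCondEntropy, ← ENNReal.tsum_fiberwise _ f, eventCondEntropy]
  refine ENNReal.tsum_le_tsum fun b => ?_
  rw [← fib, ← fib']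
  refine tsum_condTerm_le (fun y => measure_mono Set.inter_subset_right) ?_
  rw [fib']
  exact measure_ne_top _ _

lemma eventCondEntropy_le [IsProbabilityMeasure P] [Countable α] {Y : Ω → α}
    (hY : ∀ y, MeasurableSet {ω | Y ω = y}) (B : Set Ω) :
    eventCondEntropy P B Y ≤ eta (P B) := by
  refine (eventCondEntropy_le_comp hY B (fun _ => ())).trans ?_
  simp [eventCondEntropy, condTerm_one]

lemma condEntropy_le [IsProbabilityMeasure P] [Countable α] {Y : Ω → α}
    (hY : ∀ y, MeasurableSet {ω | Y ω = y}) (X : Ω → ι) : condEntropy P X Y ≤ entropy P X :=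
  ENNReal.tsum_le_tsum fun _ => eventCondEntropy_le hY _

/-- The chain rule `H(X, Y) = H(X | Y) + H(Y)`. -/
lemma entropy_pair [IsProbabilityMeasure P] [Countable ι] {X : Ω → ι}
    (hX : ∀ x, MeasurableSet {ω | X ω = x}) (Y : Ω → α) :
    entropy P (fun ω => (X ω, Y ω)) = condEntropy P X Y + entropy P Y := by
  have h : ∀ y, ∑' x, eta (P ({ω | X ω = x} ∩ {ω | Y ω = y})) =
      ∑' x, condTerm (P ({ω | X ω = x} ∩ {ω | Y ω = y})) (P {ω | Y ω = y}) +
        eta (P {ω | Y ω = y}) := by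
    intro y
    refine tsum_eta_eq ?_ prob_le_one
    simp_rw [Set.inter_comm _ {ω | Y ω = y}]
    exact tsum_measure_inter_fiber hX _
  rw [entropy_eq, entropy_eq, condEntropy]
  simp only [eventCondEntropy]
  rw [ENNReal.tsum_prod', ENNReal.tsum_comm, ENNReal.tsum_comm (α := ι), ← ENNReal.tsum_add]
  refine tsum_congr fun y => ?_
  rw [← h]
  refine tsum_congr fun x => ?_
  congr 2
  ext ω
  simp

end Random

section Independence

variable {Ω : Type*} [MeasurableSpace Ω] {P : Measure Ω} {α β ι : Type*}

/-- Conditioning on an additional independent variable does not change the conditional entropy. -/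
lemma eventCondEntropy_prod_of_indep [IsProbabilityMeasure P] [Countable β] {B : Set Ω}
    {Y : Ω → α} {Z : Ω → β} (hZ : ∀ z, MeasurableSet {ω | Z ω = z})
    (hBY : ∀ y z, P (B ∩ {ω | Y ω = y} ∩ {ω | Z ω = z}) =
      P (B ∩ {ω | Y ω = y}) * P {ω | Z ω = z})
    (hY : ∀ y z, P ({ω | Y ω = y} ∩ {ω | Z ω = z}) = P {ω | Y ω = y} * P {ω | Z ω = z}) :
    eventCondEntropy P B (fun ω => (Y ω, Z ω)) = eventCondEntropy P B Y := by
  have hset : ∀ y z, {ω | (Y ω, Z ω) = (y, z)} = {ω | Y ω = y} ∩ {ω | Z ω = z} := by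
    intro y z; ext ω; simp
  rw [eventCondEntropy, ENNReal.tsum_prod', eventCondEntropy]
  refine tsum_congr fun y => ?_
  simp_rw [hset, ← Set.inter_assoc, hBY, hY, condTerm_mul_right _ _ (measure_ne_top P _)]
  rw [ENNReal.tsum_mul_left]
  have := tsum_measure_inter_fiber hZ (P := P) Set.univ
  simp only [Set.univ_inter, measure_univ] at this
  rw [this, mul_one]

lemma condEntropy_of_indep [IsProbabilityMeasure P] [Countable α] {X : Ω → ι} {Y : Ω → α}
    (hY : ∀ y, MeasurableSet {ω | Y ω = y})
    (h : ∀ x y, P ({ω | X ω = x} ∩ {ω | Y ω = y}) = P {ω | X ω = x} * P {ω | Y ω = y}) :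
    condEntropy P X Y = entropy P X := by
  refine tsum_congr fun x => ?_
  have h1 : ∀ y, condTerm (P ({ω | X ω = x} ∩ {ω | Y ω = y})) (P {ω | Y ω = y}) =
      eta (P {ω | X ω = x}) * P {ω | Y ω = y} := by
    intro y
    rw [h, ← condTerm_one, ← condTerm_mul_right _ _ (measure_ne_top P _), one_mul]
  have := tsum_measure_inter_fiber hY (P := P) Set.univ
  simp only [Set.univ_inter, measure_univ] at this
  rw [eventCondEntropy, tsum_congr h1, ENNReal.tsum_mul_left, this, mul_one]
  rfl

end Independence

lemma condTerm_add_condTerm_le {a b a' b' : ℝ≥0∞} (h : a ≤ b) (h' : a' ≤ b') (hb : b ≠ ∞)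
    (hb' : b' ≠ ∞) : condTerm a b + condTerm a' b' ≤ condTerm (a + a') (b + b') := by
  have := tsum_condTerm_le (α := Bool) (a := fun i => bif i then a else a')
    (b := fun i => bif i then b else b') (by rintro (_ | _) <;> simpa) (by
      rw [tsum_bool]; exact ENNReal.add_ne_top.2 ⟨hb', hb⟩)
  simpa [tsum_bool, add_comm] using this

section Event

variable {Ω : Type*} [MeasurableSpace Ω] {P : Measure Ω} [IsProbabilityMeasure P] {α : Type*}

/-- If the occurrence of an event `C ⊆ B` of positive probability is revealed, then the
remaining uncertainty about `B` is strictly smaller, by strict concavity of `t ↦ -t log t`. -/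
lemma condTerm_diff_lt {B C : Set Ω} (hCB : C ⊆ B) (hC : MeasurableSet C) (hC0 : P C ≠ 0)
    (hB : P B ≠ 1) : condTerm (P (B \ C)) (P Cᶜ) < eta (P B) := by
  have hle : (P C).toReal ≤ (P B).toReal :=
    ENNReal.toReal_mono (measure_ne_top _ _) (measure_mono hCB)
  have hc : 0 < (P C).toReal := ENNReal.toReal_pos hC0 (measure_ne_top _ _)
  have hB1 : (P B).toReal < 1 := by
    have := (ENNReal.toReal_lt_toReal (measure_ne_top P B) ENNReal.one_ne_top).2
      (lt_of_le_of_ne prob_le_one hB)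
    simpa using this
  rw [measure_sdiff hCB hC.nullMeasurableSet (measure_ne_top _ _), prob_compl_eq_one_sub hC,
    condTerm, eta, ENNReal.toReal_sub_of_le (measure_mono hCB) (measure_ne_top _ _),
    ENNReal.toReal_sub_of_le prob_le_one ENNReal.one_ne_top, ENNReal.toReal_one]
  set m := (P B).toReal
  set c := (P C).toReal
  have h1c : 0 < 1 - c := by linarith
  have hu1 : (m - c) / (1 - c) < 1 := (div_lt_one h1c).2 (by linarith)
  have hstrict := Real.strictConcaveOn_negMulLog.2
    (show (m - c) / (1 - c) ∈ Set.Ici 0 from div_nonneg (by linarith) h1c.le)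
    (show (1 : ℝ) ∈ Set.Ici 0 from Set.mem_Ici.2 zero_le_one) hu1.ne h1c hc (by ring)
  simp only [smul_eq_mul, Real.negMulLog_one, mul_zero, add_zero, mul_one] at hstrict
  rw [mul_div_cancel₀ _ h1c.ne', sub_add_cancel] at hstrict
  refine (ENNReal.ofReal_lt_ofReal_iff_of_nonneg ?_).2 hstrict
  exact mul_nonneg h1c.le (Real.negMulLog_nonneg (div_nonneg (by linarith) h1c.le) hu1.le)

/-- If `Y` reveals that `B` holds at least on the event `C`, then the uncertainty about `B`
given `Y` is at most the one given the indicator of `C`. -/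
lemma eventCondEntropy_le_of_determined [Countable α] {Y : Ω → α}
    (hY : ∀ y, MeasurableSet {ω | Y ω = y}) {B C : Set Ω} {s : Set α}
    (hC : MeasurableSet C) (hCs : C ⊆ {ω | Y ω ∈ s})
    (hsB : {ω | Y ω ∈ s} ⊆ B) :
    eventCondEntropy P B Y ≤ condTerm (P (B \ C)) (P Cᶜ) := by
  classical
  set D := {ω | Y ω ∈ s} with hD
  have hDm : MeasurableSet D := by
    have : D = ⋃ y ∈ s, {ω | Y ω = y} := by ext; simp [hD]
    rw [this]
    exact MeasurableSet.biUnion s.to_countable fun y _ => hY y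
  have h1 : eventCondEntropy P B (fun ω => decide (Y ω ∈ s)) =
      condTerm (P (B ∩ D)) (P D) + condTerm (P (B \ D)) (P Dᶜ) := by
    rw [eventCondEntropy, tsum_bool, add_comm]
    simp [hD, Set.sdiff_eq, Set.compl_ofPred]
  refine (eventCondEntropy_le_comp hY B fun y => decide (y ∈ s)).trans ?_
  rw [h1, Set.inter_eq_right.2 hsB, condTerm_self, zero_add]
  calc condTerm (P (B \ D)) (P Dᶜ)
      = condTerm (P (B \ D)) (P Dᶜ) + condTerm (P (D \ C)) (P (D \ C)) := by
        rw [condTerm_self, add_zero]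
    _ ≤ condTerm (P (B \ D) + P (D \ C)) (P Dᶜ + P (D \ C)) :=
        condTerm_add_condTerm_le (measure_mono fun ω h => h.2) le_rfl (measure_ne_top _ _)
          (measure_ne_top _ _)
    _ = _ := by
        rw [← measure_union (Set.disjoint_left.2 fun ω h h' => h.2 h'.1) (hDm.diff hC),
          ← measure_union (Set.disjoint_left.2 fun ω (h : ω ∈ Dᶜ) h' => h h'.1) (hDm.diff hC)]
        congr 2 <;> ext ω <;> have h1 := @hCs ω <;> have h2 := @hsB ω <;>
          simp only [Set.mem_union, Set.mem_sdiff, Set.mem_compl_iff] <;> tauto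

end Event

lemma tsum_condTerm_inter_le {Ω α : Type*} [MeasurableSpace Ω] {P : Measure Ω}
    [IsProbabilityMeasure P] (Y : Ω → α)
    {N : Set Ω} (hN : MeasurableSet N) (B : Set Ω) :
    ∑' y, condTerm (P ((N ∩ {ω | Y ω = y}) ∩ B)) (P (N ∩ {ω | Y ω = y})) ≤
      eventCondEntropy P B Y := by
  refine ENNReal.tsum_le_tsum fun y => ?_
  have h1 : P (B ∩ {ω | Y ω = y}) =
      P ((N ∩ {ω | Y ω = y}) ∩ B) + P ((B ∩ {ω | Y ω = y}) \ N) := by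
    rw [← measure_inter_add_sdiff (B ∩ {ω | Y ω = y}) hN]
    congr 2
    ext; simp only [Set.mem_inter_iff]; tauto
  have h2 : P {ω | Y ω = y} = P (N ∩ {ω | Y ω = y}) + P ({ω | Y ω = y} \ N) := by
    rw [← measure_inter_add_sdiff {ω | Y ω = y} hN, Set.inter_comm]
  rw [h1, h2]
  refine le_trans le_self_add (condTerm_add_condTerm_le (measure_mono Set.inter_subset_left)
    (measure_mono (Set.sdiff_subset_sdiff_left Set.inter_subset_right)) (measure_ne_top _ _)
    (measure_ne_top _ _))

/-! ### The multiset of edges of the walk -/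

section Walk

variable {G : Type*} [Group G]

@[simp] lemma walk_zero (ω : ℕ → G) : walk ω 0 = 1 := rfl

lemma walk_succ (ω : ℕ → G) (n : ℕ) : walk ω (n + 1) = walk ω n * ω n := rfl

lemma walk_add (ω : ℕ → G) (m n : ℕ) :
    walk ω (m + n) = walk ω m * walk (fun i => ω (i + m)) n := by
  induction n with
  | zero => simp
  | succ n ih => rw [← add_assoc, walk_succ, ih, walk_succ, mul_assoc, add_comm n m]

lemma walk_succ' (ω : ℕ → G) (n : ℕ) :
    walk ω (n + 1) = ω 0 * walk (fun i => ω (i + 1)) n := by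
  rw [add_comm, walk_add]
  simp [walk_succ]

lemma walk_congr {ω ω' : ℕ → G} {n : ℕ} (h : ∀ i < n, ω i = ω' i) : walk ω n = walk ω' n := by
  induction n with
  | zero => rfl
  | succ n ih => rw [walk_succ, walk_succ, ih fun i hi => h i (hi.trans n.lt_succ_self),
      h n n.lt_succ_self]

/-- The multiset of the edges `(S_i, S_{i+1})`, `i < n`, traversed in the first `n` steps. -/
def edgeMultiset (n : ℕ) (ω : ℕ → G) : Multiset (G × G) :=
  (Multiset.range n).map fun i => (walk ω i, walk ω (i + 1))

lemma edgeMultiset_congr {ω ω' : ℕ → G} {n : ℕ} (h : ∀ i < n, ω i = ω' i) :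
    edgeMultiset n ω = edgeMultiset n ω' := by
  refine Multiset.map_congr rfl fun i hi => ?_
  rw [Multiset.mem_range] at hi
  rw [walk_congr fun j hj => h j (hj.trans hi),
    walk_congr (n := i + 1) fun j hj => h j (hj.trans_le hi)]

lemma edgeMultiset_succ (n : ℕ) (ω : ℕ → G) :
    edgeMultiset (n + 1) ω = (walk ω n, walk ω (n + 1)) ::ₘ edgeMultiset n ω := by
  simp [edgeMultiset, Multiset.range_succ]

/-- Decomposition at the first step: the later edges are those of the shifted walk, translated
by the first increment. -/
lemma edgeMultiset_succ' (n : ℕ) (ω : ℕ → G) :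
    edgeMultiset (n + 1) ω = (1, ω 0) ::ₘ
      (edgeMultiset n fun i => ω (i + 1)).map fun a => (ω 0 * a.1, ω 0 * a.2) := by
  induction n with
  | zero => simp [edgeMultiset, walk_succ]
  | succ n ih =>
    rw [edgeMultiset_succ, ih, edgeMultiset_succ, Multiset.map_cons, Multiset.cons_swap]
    simp [walk_succ']

/-- Every site is entered as often as it is left, up to the two ends of the path. -/
lemma edgeMultiset_endpoint (n : ℕ) (ω : ℕ → G) :
    (edgeMultiset n ω).map Prod.fst + {walk ω n} = {1} + (edgeMultiset n ω).map Prod.snd := by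
  induction n with
  | zero => simp [edgeMultiset]
  | succ n ih =>
    rw [edgeMultiset_succ, Multiset.map_cons, Multiset.map_cons, Multiset.add_cons, ← ih,
      ← Multiset.singleton_add, ← Multiset.singleton_add]
    simp only
    abel

/-- The end of the path is a function of the multiset of its edges. -/
lemma exists_endpoint :
    ∃ e : Multiset (G × G) → G, ∀ n (ω : ℕ → G), e (edgeMultiset n ω) = walk ω n := by
  classical
  refine ⟨fun w => Classical.epsilon fun g => w.map Prod.fst + {g} = {1} + w.map Prod.snd,
    fun n ω => ?_⟩
  have h := Classical.epsilon_spec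
    (p := fun g => (edgeMultiset n ω).map Prod.fst + {g} = {1} + (edgeMultiset n ω).map Prod.snd)
    ⟨_, edgeMultiset_endpoint n ω⟩
  exact Multiset.singleton_inj.1 (add_left_cancel (h.trans (edgeMultiset_endpoint n ω).symm))

open Classical in
/-- The weighted digraph of a path from the identity, in terms of the multiset of its edges. The
identity is added to the vertices for the sake of the path of length `0`. -/
noncomputable def digraphOfMultiset (w : Multiset (G × G)) : WeightedDigraph G where
  verts := {g | g = 1 ∨ ∃ a ∈ w, g = a.1 ∨ g = a.2}
  edges := {a | a ∈ w}
  weight a := w.count a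
  mem_verts a ha := ⟨Or.inr ⟨a, ha, Or.inl rfl⟩, Or.inr ⟨a, ha, Or.inr rfl⟩⟩
  weight_eq_zero _ ha := Multiset.count_eq_zero_of_notMem ha

lemma digraphOfMultiset_injective :
    Function.Injective (digraphOfMultiset : Multiset (G × G) → WeightedDigraph G) := by
  classical
  intro w w' h
  ext a
  have := congrFun (congrArg WeightedDigraph.weight h) a
  simp only [digraphOfMultiset] at this
  convert this

lemma trace_eq (n : ℕ) (ω : ℕ → G) : trace n ω = digraphOfMultiset (edgeMultiset n ω) := by
  classical
  ext a
  · simp only [trace, digraphOfMultiset, edgeMultiset, Set.mem_ofPred_eq, Multiset.mem_map,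
      Multiset.mem_range]
    constructor
    · rintro ⟨i, hi, rfl⟩
      rcases i with _ | i
      · exact Or.inl rfl
      · exact Or.inr ⟨_, ⟨i, hi, rfl⟩, Or.inr rfl⟩
    · rintro (rfl | ⟨_, ⟨i, hi, rfl⟩, rfl | rfl⟩)
      · exact ⟨0, Nat.zero_le _, rfl⟩
      · exact ⟨i, hi.le, rfl⟩
      · exact ⟨i + 1, hi, rfl⟩
  · simp [trace, digraphOfMultiset, edgeMultiset, Prod.ext_iff]
  · rename_i a
    simp only [trace, digraphOfMultiset, edgeMultiset, Multiset.count_map]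
    rw [← Finset.card_filter, Finset.card_def, Finset.filter_val, Finset.range_val]
    congr 1
    refine Multiset.filter_congr fun i _ => ?_
    rw [Prod.ext_iff]
    exact and_congr eq_comm eq_comm

end Walk

/-! ### Coordinates of the path measure and the first-step decomposition -/

section Coordinates

variable {G : Type*} [MeasurableSpace G] {μ : Measure G} [IsProbabilityMeasure μ]

instance : IsProbabilityMeasure (pathMeasure μ) :=
  inferInstanceAs (IsProbabilityMeasure (Measure.infinitePi _))

lemma measurePreserving_reindex {e : ℕ → ℕ} (he : e.Injective) :
    MeasurePreserving (fun (ω : ℕ → G) i => ω (e i)) (pathMeasure μ) (pathMeasure μ) :=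
  ⟨by fun_prop, Measure.map_infinitePi_infinitePi_of_inj (P := fun _ => μ) he⟩

variable [MeasurableSingletonClass G]

lemma measurableSet_coord (i : ℕ) (x : G) : MeasurableSet {ω : ℕ → G | ω i = x} :=
  measurable_pi_apply (X := fun _ : ℕ => G) i (measurableSet_singleton x)

lemma pathMeasure_coord (i : ℕ) (x : G) :
    pathMeasure μ {ω | ω i = x} = μ {x} :=
  (measurePreserving_eval_infinitePi (fun _ => μ) i).measure_preimage
    (measurableSet_singleton x).nullMeasurableSet

end Coordinates

section Path

lemma dependsOn_edgeMultiset {G : Type*} [Group G] (n : ℕ) :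
    DependsOn (edgeMultiset (G := G) n) (Finset.range n : Finset ℕ) :=
  fun _ _ h => edgeMultiset_congr fun i hi => h i (by simpa using hi)

variable {G : Type*} [Group G] [Countable G] [MeasurableSpace G] [MeasurableSingletonClass G]
  {μ : Measure G} [IsProbabilityMeasure μ]

lemma factors_of_dependsOn {β : Type*} [MeasurableSpace β] {f : (ℕ → G) → β} {s : Finset ℕ}
    (hf : DependsOn f s) : ∃ g : (s → G) → β, Measurable g ∧ f = g ∘ s.restrict := by
  classical
  refine ⟨fun y => f fun i => if h : i ∈ s then y ⟨i, h⟩ else 1, measurable_of_countable _, ?_⟩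
  ext1 ω
  refine hf fun i hi => ?_
  have : i ∈ s := hi
  simp [this]

lemma measurable_of_dependsOn {β : Type*} [MeasurableSpace β] {f : (ℕ → G) → β} {s : Finset ℕ}
    (hf : DependsOn f s) : Measurable f := by
  obtain ⟨g, hg, rfl⟩ := factors_of_dependsOn hf
  exact hg.comp (Finset.measurable_restrict s)

lemma measurableSet_of_dependsOn {p : (ℕ → G) → Prop} {s : Finset ℕ}
    (hp : DependsOn p s) : MeasurableSet {ω | p ω} :=
  measurableSet_setOfPred.2 (measurable_of_dependsOn hp)

lemma indepFun_of_dependsOn {β : Type*} [MeasurableSpace β] {f : (ℕ → G) → β} {s : Finset ℕ}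
    (hf : DependsOn f s) {i : ℕ} (hi : i ∉ s) :
    ProbabilityTheory.IndepFun f (fun ω => ω i) (pathMeasure μ) := by
  obtain ⟨g, hg, rfl⟩ := factors_of_dependsOn hf
  have h := (ProbabilityTheory.iIndepFun_infinitePi (P := fun _ : ℕ => μ)
    (X := fun _ (x : G) => x) fun _ => measurable_id).indepFun_finset s {i}
      (Finset.disjoint_singleton_right.2 hi) fun j => measurable_pi_apply j
  exact h.comp hg (measurable_pi_apply (⟨i, Finset.mem_singleton_self i⟩ : ({i} : Finset ℕ)))

lemma measure_inter_coord {p : (ℕ → G) → Prop} {s : Finset ℕ} (hp : DependsOn p s) {i : ℕ}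
    (hi : i ∉ s) (x : G) :
    pathMeasure μ ({ω | p ω} ∩ {ω | ω i = x}) = pathMeasure μ {ω | p ω} * μ {x} := by
  have h := (indepFun_of_dependsOn (μ := μ) hp hi).measure_inter_preimage_eq_mul {True} {x}
    (MeasurableSet.singleton _) (measurableSet_singleton x)
  rw [← pathMeasure_coord (μ := μ) i x]
  convert h using 3 <;> ext <;> simp

lemma measurableSet_edgeMultiset (n : ℕ) (w : Multiset (G × G)) :
    MeasurableSet {ω | edgeMultiset n ω = w} :=
  measurableSet_of_dependsOn (s := Finset.range n) fun _ _ h => by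
    rw [dependsOn_edgeMultiset n h]

/-- The recursion `H(X₁ | Wₙ₊₁) + H(Wₙ₊₁) = H(X₁) + H(Wₙ)` for the multisets of edges: both
sides are the entropy of the pair `(X₁, Wₙ₊₁)`. -/
lemma entropy_edgeMultiset_succ (n : ℕ) :
    condEntropy (pathMeasure μ) (fun ω => ω 0) (edgeMultiset (G := G) (n + 1)) +
        entropy (pathMeasure μ) (edgeMultiset (G := G) (n + 1)) =
      entropy (pathMeasure μ) (fun ω : ℕ → G => ω 0) +
        entropy (pathMeasure μ) (edgeMultiset (G := G) n) := by
  -- `(X₁, Wₙ₊₁)` is the image under `F` of `X₁` and the multiset of edges of the shifted walk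
  let F : G × Multiset (G × G) → G × Multiset (G × G) := fun a =>
    (a.1, (1, a.1) ::ₘ a.2.map fun b => (a.1 * b.1, a.1 * b.2))
  have hF : F.Injective := by
    rintro ⟨x, w⟩ ⟨y, w'⟩ h
    simp only [F, Prod.mk.injEq] at h
    obtain ⟨rfl, h⟩ := h
    rw [Multiset.cons_inj_right] at h
    rw [Multiset.map_injective (fun a b hab => ?_) h]
    simpa [Prod.ext_iff] using hab
  have hs := measurePreserving_reindex (μ := μ) (add_left_injective 1)
  have hdep : ∀ w, DependsOn (fun ω : ℕ → G => edgeMultiset n (fun i => ω (i + 1)) = w)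
      (Finset.Icc 1 n : Finset ℕ) := by
    intro w ω ω' h
    simp only
    rw [edgeMultiset_congr fun i hi => h (i + 1) (by simp; omega)]
  have hlaw : ∀ w, pathMeasure μ {ω : ℕ → G | edgeMultiset n (fun i => ω (i + 1)) = w} =
      pathMeasure μ {ω | edgeMultiset n ω = w} := fun w =>
    hs.measure_preimage (measurableSet_edgeMultiset n w).nullMeasurableSet
  rw [← entropy_pair (measurableSet_coord 0)]
  have h1 : (fun ω : ℕ → G => (ω 0, edgeMultiset (n + 1) ω)) =
      fun ω => F (ω 0, edgeMultiset n fun i => ω (i + 1)) := by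
    ext1 ω
    rw [edgeMultiset_succ']
  rw [h1, entropy_comp_injective _ hF, entropy_pair (measurableSet_coord 0), condEntropy_of_indep]
  · congr 1
    exact tsum_congr fun w => congrArg eta (hlaw w)
  · exact fun w => measurableSet_of_dependsOn (hdep w)
  · intro x w
    rw [Set.inter_comm, measure_inter_coord (hdep w) (by simp), pathMeasure_coord, mul_comm]

/-- Longer paths carry less information on the first step. The bound `1 ≤ n` is needed: the
empty path reveals nothing, the first step reveals itself. -/
lemma eventCondEntropy_edgeMultiset_le_succ {n : ℕ} (hn : 1 ≤ n) (x : G) :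
    eventCondEntropy (pathMeasure μ) {ω | ω 0 = x} (edgeMultiset (G := G) n) ≤
      eventCondEntropy (pathMeasure μ) {ω | ω 0 = x} (edgeMultiset (G := G) (n + 1)) := by
  obtain ⟨e, he⟩ := exists_endpoint (G := G)
  have hY := dependsOn_edgeMultiset (G := G) n
  rw [← eventCondEntropy_prod_of_indep (Z := fun ω : ℕ → G => ω n) (measurableSet_coord n)]
  · refine (eventCondEntropy_le_comp ?_ _ fun a : Multiset (G × G) × G =>
      (e a.1, e a.1 * a.2) ::ₘ a.1).trans_eq ?_
    · rintro ⟨w, y⟩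
      convert (measurableSet_edgeMultiset n w).inter (measurableSet_coord n y) using 1
      ext ω
      simp
    · congr 1
      ext1 ω
      rw [he, edgeMultiset_succ, walk_succ]
  · intro w y
    rw [pathMeasure_coord]
    refine measure_inter_coord (p := fun ω => ω 0 = x ∧ edgeMultiset n ω = w)
      (s := Finset.range n) (fun ω ω' h => ?_) (by simp) y
    simp only
    rw [hY h, h 0 (by simp; omega)]
  · intro w y
    rw [pathMeasure_coord]
    refine measure_inter_coord (s := Finset.range n) (fun ω ω' h => ?_) (by simp) y
    rw [hY h]

end Path

/-! ### The entropy rate and the transient case -/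

/-- Cesàro averaging for a sequence with increments `A - c n`. -/
lemma tendsto_div_of_add_eq {H c : ℕ → ℝ≥0∞} {A : ℝ≥0∞} (hA : A ≠ ∞) (h0 : H 0 = 0)
    (hc : Monotone c) (hcA : ∀ n, c n ≤ A) (hrec : ∀ n, c n + H (n + 1) = A + H n) :
    Tendsto (fun n => H n / (n : ℝ≥0∞)) atTop (𝓝 (A - ⨆ n, c n)) := by
  have hCA : ⨆ n, c n ≤ A := iSup_le hcA
  have hct : ∀ n, c n ≠ ∞ := fun n => ne_top_of_le_ne_top hA (hcA n)
  have hH : ∀ n, H n ≠ ∞ := by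
    intro n
    induction n with
    | zero => simp [h0]
    | succ n ih =>
      refine ne_top_of_le_ne_top (ENNReal.add_ne_top.2 ⟨hA, ih⟩) ?_
      rw [← hrec]
      exact le_add_self
  have hdiff : ∀ n, (H (n + 1)).toReal - (H n).toReal = A.toReal - (c n).toReal := by
    intro n
    have := congrArg ENNReal.toReal (hrec n)
    rw [ENNReal.toReal_add (hct n) (hH _), ENNReal.toReal_add hA (hH n)] at this
    linarith
  have hlim : Tendsto (fun n => A.toReal - (c n).toReal) atTop
      (𝓝 (A.toReal - (⨆ n, c n).toReal)) :=
    tendsto_const_nhds.sub ((ENNReal.tendsto_toReal (ne_top_of_le_ne_top hA hCA)).comp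
      (tendsto_atTop_iSup hc))
  have hces := hlim.cesaro
  simp_rw [← hdiff, Finset.sum_range_sub (fun n => (H n).toReal), h0, ENNReal.toReal_zero,
    sub_zero] at hces
  rw [← ENNReal.toReal_sub_of_le hCA hA] at hces
  have := (ENNReal.continuous_ofReal.tendsto _).comp hces
  rw [ENNReal.ofReal_toReal (ne_top_of_le_ne_top hA tsub_le_self)] at this
  refine this.congr' ?_
  filter_upwards [eventually_gt_atTop 0] with n hn
  have hn' : (0 : ℝ) < n := by exact_mod_cast hn
  rw [Function.comp_apply, mul_comm, ← div_eq_mul_inv, ENNReal.ofReal_div_of_pos hn',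
    ENNReal.ofReal_toReal (hH n), ENNReal.ofReal_natCast]

section Transient

variable {G : Type*} [Group G] [Countable G] [MeasurableSpace G] [MeasurableSingletonClass G]
  {μ : Measure G} [IsProbabilityMeasure μ]

lemma measurableSet_walk (n : ℕ) (g : G) : MeasurableSet {ω : ℕ → G | walk ω n = g} :=
  measurableSet_of_dependsOn (s := Finset.range n) fun ω ω' h => by
    rw [walk_congr fun i hi => h i (by simpa using hi)]

/-- For a transient walk the path reveals a positive amount of information on the first step. -/
lemma exists_iSup_condEntropy_lt (hpos : entropy (pathMeasure μ) (fun ω : ℕ → G => ω 0) ≠ 0)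
    (hfin : entropy (pathMeasure μ) (fun ω : ℕ → G => ω 0) ≠ ∞) (hrec : ¬ IsRecurrent μ) :
    ⨆ n, condEntropy (pathMeasure μ) (fun ω => ω 0) (edgeMultiset (G := G) (n + 1)) <
      entropy (pathMeasure μ) (fun ω : ℕ → G => ω 0) := by
  classical
  set P := pathMeasure μ with hP
  set N : Set (ℕ → G) := {ω | ∀ n, 1 ≤ n → walk ω n ≠ 1} with hN
  have hNm : MeasurableSet N := by
    have : N = ⋂ n : ℕ, ⋂ _ : 1 ≤ n, {ω | walk ω n = 1}ᶜ := by ext; simp [hN]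
    rw [this]
    exact MeasurableSet.iInter fun n => MeasurableSet.iInter fun _ => (measurableSet_walk n 1).compl
  have hN0 : P N ≠ 0 := by
    contrapose! hrec
    rw [IsRecurrent, ae_iff, ← hP, ← hrec]
    congr 1
    ext ω
    simp [hN]
  rw [← tsum_measure_inter_fiber (measurableSet_coord 0)] at hN0
  obtain ⟨x₀, hx₀⟩ : ∃ x₀, P (N ∩ {ω | ω 0 = x₀}) ≠ 0 := by
    by_contra! h
    exact hN0 (ENNReal.tsum_eq_zero.2 h)
  set B : Set (ℕ → G) := {ω | ω 0 = x₀} with hB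
  have hBm : MeasurableSet B := measurableSet_coord 0 x₀
  have hB1 : P B ≠ 1 := by
    contrapose! hpos
    refine ENNReal.tsum_eq_zero.2 fun x => ?_
    change eta (P {ω | ω 0 = x}) = 0
    rcases eq_or_ne x x₀ with rfl | hx
    · rw [hpos]; simp [eta]
    · have h0 : P Bᶜ = 0 := (prob_compl_eq_zero_iff hBm).2 hpos
      rw [measure_mono_null (fun ω h => ?_) h0, eta_zero]
      exact fun h' => hx ((Set.mem_ofPred_eq.mp h).symm.trans h')
  set F := condTerm (P (B \ (N ∩ B))) (P (N ∩ B)ᶜ)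
  have hlt : F < eta (P B) := condTerm_diff_lt Set.inter_subset_right (hNm.inter hBm) hx₀ hB1
  have hbound : ∀ n, eventCondEntropy P B (edgeMultiset (G := G) (n + 1)) ≤ F := by
    intro n
    -- the edges reveal that the first step is `x₀` if `(1, x₀)` is the only edge out of `1`
    refine eventCondEntropy_le_of_determined (measurableSet_edgeMultiset _)
      (s := {w | w.filter (fun a => a.1 = 1) = {(1, x₀)}}) (hNm.inter hBm) ?_ ?_
    · rintro ω ⟨h1, h2⟩
      have h2 : ω 0 = x₀ := h2
      change Multiset.filter _ _ = _
      rw [edgeMultiset_succ', Multiset.filter_cons_of_pos (p := fun a : G × G => a.1 = 1) _ rfl,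
        h2, Multiset.filter_eq_nil.2, Multiset.cons_zero]
      intro a ha
      obtain ⟨b, hb, rfl⟩ := Multiset.mem_map.1 ha
      obtain ⟨i, -, rfl⟩ := Multiset.mem_map.1 hb
      have := h1 (i + 1) (by omega)
      rwa [walk_succ', h2] at this
    · intro ω h
      have h : Multiset.filter _ _ = _ := h
      have hmem : ((1 : G), ω 0) ∈ (edgeMultiset (n + 1) ω).filter fun a => a.1 = 1 := by
        rw [edgeMultiset_succ']
        simp
      rw [h, Multiset.mem_singleton, Prod.mk.injEq] at hmem
      exact hmem.2
  have hA' : ∑' x, (if x = x₀ then F else eta (P {ω | ω 0 = x})) <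
      entropy P (fun ω : ℕ → G => ω 0) := by
    have hle : ∀ x, (if x = x₀ then F else eta (P {ω | ω 0 = x})) ≤ eta (P {ω | ω 0 = x}) := by
      intro x
      split_ifs with h
      · rw [h]; exact hlt.le
      · exact le_rfl
    refine ENNReal.tsum_lt_tsum (i := x₀)
      (ne_top_of_le_ne_top hfin (ENNReal.tsum_le_tsum hle)) hle ?_
    rw [if_pos rfl]
    exact hlt
  refine (iSup_le fun n => ENNReal.tsum_le_tsum fun x => ?_).trans_lt hA'
  split_ifs with h
  · rw [h]; exact hbound n
  · exact eventCondEntropy_le (measurableSet_edgeMultiset _) _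

end Transient

/-! ### Rotating a loop -/

section Rotation

/-- The rotation of `{0, …, T - 1}` which moves `s` to the front; the other times are fixed.
Composing an increment sequence with it exchanges the blocks `[0, s)` and `[s, T)`. -/
def rotateBlock (s T i : ℕ) : ℕ :=
  if i < T - s then i + s else if i < T then i - (T - s) else i

lemma rotateBlock_injective (s T : ℕ) (h : s ≤ T) : Function.Injective (rotateBlock s T) := by
  intro i j hij
  simp only [rotateBlock] at hij
  split_ifs at hij <;> omega

lemma map_rotateBlock_range {s T n : ℕ} (h : s ≤ T) (hn : T ≤ n) :
    (Finset.range n).map ⟨rotateBlock s T, rotateBlock_injective s T h⟩ = Finset.range n := by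
  refine Finset.eq_of_subset_of_card_le (fun j hj => ?_) (by simp)
  simp only [Finset.mem_map, Finset.mem_range, Function.Embedding.coeFn_mk] at hj ⊢
  obtain ⟨i, hi, rfl⟩ := hj
  simp only [rotateBlock]
  split_ifs <;> omega

variable {G : Type*} [Group G]

open Classical in
/-- The number of visits of the walk to the identity before time `T`, time `0` included. -/
noncomputable def visits (T : ℕ) (ω : ℕ → G) : ℕ :=
  ∑ i ∈ Finset.range T, if walk ω i = 1 then 1 else 0

@[simp] lemma visits_zero (ω : ℕ → G) : visits 0 ω = 0 := rfl

open Classical in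
lemma visits_succ (T : ℕ) (ω : ℕ → G) :
    visits (T + 1) ω = visits T ω + if walk ω T = 1 then 1 else 0 :=
  Finset.sum_range_succ _ _

lemma visits_mono (ω : ℕ → G) : Monotone fun T => visits T ω :=
  monotone_nat_of_le_succ fun T => by simp [visits_succ]

lemma visits_congr {ω ω' : ℕ → G} {n : ℕ} (h : ∀ i < n, ω i = ω' i) :
    visits n ω = visits n ω' := by
  refine Finset.sum_congr rfl fun i hi => ?_
  rw [walk_congr fun j hj => h j (hj.trans (Finset.mem_range.1 hi))]

variable {ω : ℕ → G} {s T : ℕ}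

lemma walk_rotateBlock (hs : s < T) (h1 : walk ω s = 1) (h2 : walk ω T = 1) (i : ℕ) :
    walk (fun j => ω (rotateBlock s T j)) i = walk ω (rotateBlock s T i) := by
  induction i with
  | zero => simp [rotateBlock, hs, h1]
  | succ i ih =>
    rw [walk_succ, ih, ← walk_succ]
    by_cases ha : i + 1 = T - s
    · rcases Nat.eq_zero_or_pos s with rfl | h0
      · congr 1
        simp only [rotateBlock]
        split_ifs <;> omega
      · rw [show rotateBlock s T i + 1 = T by simp only [rotateBlock]; split_ifs <;> omega,
          show rotateBlock s T (i + 1) = 0 by simp only [rotateBlock]; split_ifs <;> omega, h2,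
          walk_zero]
    by_cases hb : i + 1 = T
    · rw [show rotateBlock s T i + 1 = s by simp only [rotateBlock]; split_ifs <;> omega,
        show rotateBlock s T (i + 1) = T by simp only [rotateBlock]; split_ifs <;> omega, h2, h1]
    · congr 1
      simp only [rotateBlock]
      split_ifs <;> omega

lemma visits_rotateBlock (hs : s < T) (h1 : walk ω s = 1) (h2 : walk ω T = 1) :
    visits T (fun j => ω (rotateBlock s T j)) = visits T ω := by
  rw [visits, visits]
  conv_rhs => rw [← map_rotateBlock_range hs.le le_rfl, Finset.sum_map]
  refine Finset.sum_congr rfl fun i _ => ?_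
  rw [walk_rotateBlock hs h1 h2]
  rfl

lemma edgeMultiset_rotateBlock {n : ℕ} (hs : s < T) (hn : T ≤ n) (h1 : walk ω s = 1)
    (h2 : walk ω T = 1) :
    edgeMultiset n (fun j => ω (rotateBlock s T j)) = edgeMultiset n ω := by
  have hr : Multiset.range n = (Multiset.range n).map (rotateBlock s T) := by
    have := congrArg Finset.val (map_rotateBlock_range hs.le hn)
    rw [Finset.map_val, Finset.range_val] at this
    exact this.symm
  conv_rhs => rw [edgeMultiset, hr, Multiset.map_map]
  refine Multiset.map_congr rfl fun i _ => ?_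
  simp only [Function.comp_apply]
  rw [walk_succ, walk_rotateBlock hs h1 h2, ← walk_succ]

/-- The event that the `k`-th return to the identity happens at time `T`, and that the edges
traversed up to time `n` form the multiset `w`. Time `0` is one of the `visits` counted, but `T`
is not, so that the number of visits before `T` is the number of returns up to `T`. -/
def kthReturn (k T n : ℕ) (w : Multiset (G × G)) : Set (ℕ → G) :=
  {ω | walk ω T = 1 ∧ visits T ω = k ∧ edgeMultiset n ω = w}

lemma rotateBlock_mem_kthReturn {k n : ℕ} {w : Multiset (G × G)} (hs : s < T)
    (hT : T ≤ n) (h1 : walk ω s = 1) (h : ω ∈ kthReturn k T n w) :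
    (fun j => ω (rotateBlock s T j)) ∈ kthReturn k T n w := by
  obtain ⟨h2, h3, h4⟩ := h
  refine ⟨?_, ?_, ?_⟩
  · rw [walk_rotateBlock hs h1 h2]
    convert h2
    simp [rotateBlock]
  · rw [visits_rotateBlock hs h1 h2, h3]
  · rw [edgeMultiset_rotateBlock hs hT h1 h2, h4]

end Rotation

section Exchange

variable {G : Type*} [Group G] [Countable G] [MeasurableSpace G] [MeasurableSingletonClass G]
  {μ : Measure G} [IsProbabilityMeasure μ]

lemma measurableSet_kthReturn {k T n : ℕ} (hT : T ≤ n) (w : Multiset (G × G)) :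
    MeasurableSet (kthReturn k T n w) := by
  refine measurableSet_of_dependsOn (s := Finset.range n) fun ω ω' h => ?_
  have h' : ∀ i < n, ω i = ω' i := fun i hi => h i (by simpa using hi)
  rw [walk_congr fun i hi => h' i (hi.trans_le hT), visits_congr fun i hi => h' i (hi.trans_le hT),
    edgeMultiset_congr h']

/-- Rotating a loop of length `T` at its visit to the identity at time `s` turns the step taken
at time `s` into the first step, and the visit at time `s` into a visit at time `T - s`. -/
lemma measure_rotateBlock {k s T n : ℕ} (hs : s < T) (hT : T ≤ n) (x : G)
    (w : Multiset (G × G)) :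
    pathMeasure μ (kthReturn k T n w ∩ {ω | walk ω s = 1 ∧ ω s = x}) =
      pathMeasure μ (kthReturn k T n w ∩ {ω | walk ω (T - s) = 1 ∧ ω 0 = x}) := by
  have hm : ∀ i j : ℕ,
      MeasurableSet (kthReturn k T n w ∩ {ω : ℕ → G | walk ω i = 1 ∧ ω j = x}) := fun i j =>
    (measurableSet_kthReturn hT w).inter ((measurableSet_walk i 1).inter (measurableSet_coord j x))
  have hp : ∀ r, r < T → MeasurePreserving (fun (ω : ℕ → G) i => ω (rotateBlock r T i))
      (pathMeasure μ) (pathMeasure μ) := fun r hr =>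
    measurePreserving_reindex (rotateBlock_injective r T hr.le)
  -- for `s = 0` both events agree; otherwise the rotations by `s` and by `T - s` are inverse
  rcases Nat.eq_zero_or_pos s with rfl | h0
  · congr 1
    ext ω
    simp only [kthReturn, Set.mem_inter_iff, Set.mem_ofPred_eq, walk_zero, Nat.sub_zero]
    tauto
  apply le_antisymm
  · refine (measure_mono ?_).trans
      ((hp s hs).measure_preimage (hm (T - s) 0).nullMeasurableSet).le
    rintro ω ⟨h, h1, h2⟩
    refine ⟨rotateBlock_mem_kthReturn hs hT h1 h, ?_, ?_⟩
    · rw [walk_rotateBlock hs h1 h.1,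
        show rotateBlock s T (T - s) = 0 by simp only [rotateBlock]; split_ifs <;> omega, walk_zero]
    · change ω (rotateBlock s T 0) = x
      rw [← h2, show rotateBlock s T 0 = s by simp only [rotateBlock]; split_ifs <;> omega]
  · have hr : T - s < T := by omega
    refine (measure_mono ?_).trans
      ((hp (T - s) hr).measure_preimage (hm s s).nullMeasurableSet).le
    rintro ω ⟨h, h1, h2⟩
    have e : rotateBlock (T - s) T s = 0 := by simp only [rotateBlock]; split_ifs <;> omega
    refine ⟨rotateBlock_mem_kthReturn hr hT h1 h, ?_, ?_⟩
    · rw [walk_rotateBlock hr h1 h.1, e, walk_zero]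
    · change ω (rotateBlock (T - s) T s) = x
      rw [e, h2]

end Exchange

/-! ### The steps taken at the visits to the identity -/

open Classical in
lemma sum_measure_inter {Ω ι : Type*} [MeasurableSpace Ω] {P : Measure Ω} (S : Finset ι)
    (A : Set Ω) {p : ι → Ω → Prop} (hp : ∀ i, MeasurableSet {ω | p i ω}) :
    ∑ i ∈ S, P (A ∩ {ω | p i ω}) =
      ∫⁻ ω in A, ((∑ i ∈ S, if p i ω then 1 else 0 : ℕ) : ℝ≥0∞) ∂P := by
  have h : ∀ ω, ((∑ i ∈ S, if p i ω then 1 else 0 : ℕ) : ℝ≥0∞) =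
      ∑ i ∈ S, {ω | p i ω}.indicator (fun _ => (1 : ℝ≥0∞)) ω := by
    intro ω
    push_cast
    refine Finset.sum_congr rfl fun i _ => ?_
    by_cases hi : p i ω <;> simp [Set.indicator, hi]
  simp_rw [h]
  rw [lintegral_finsetSum _ fun i _ => measurable_const.indicator (hp i)]
  refine Finset.sum_congr rfl fun i _ => ?_
  rw [lintegral_indicator_const (hp i), one_mul, Measure.restrict_apply (hp i), Set.inter_comm]

section Counting

variable {G : Type*} [Group G]

open Classical in
/-- The number of steps `x` among the steps taken before time `n` at one of the first `k` visits
to the identity. -/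
noncomputable def exitCount (k n : ℕ) (x : G) (ω : ℕ → G) : ℕ :=
  ∑ i ∈ Finset.range n, if (walk ω i = 1 ∧ visits i ω < k) ∧ ω i = x then 1 else 0

open Classical in
/-- The sum, over the first `k` visits to the identity before time `n`, of the differences
between the indicator that the step taken is `x` and the constant `m`. For `m = μ {x}` it is a
martingale in `n`. -/
noncomputable def exitDeviation (m : ℝ) (k n : ℕ) (x : G) (ω : ℕ → G) : ℝ :=
  ∑ i ∈ Finset.range n,
    (if walk ω i = 1 ∧ visits i ω < k then 1 else 0) * ((if ω i = x then 1 else 0) - m)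

variable {ω : ℕ → G} {k T n : ℕ} {x : G}

lemma visits_lt {i : ℕ} (hi : walk ω i = 1) (hiT : i < T) : visits i ω < visits T ω := by
  have h1 := visits_succ i ω
  rw [if_pos hi] at h1
  have h2 : visits (i + 1) ω ≤ visits T ω := visits_mono ω hiT
  omega

open Classical in
lemma sum_early_visits (k n : ℕ) (ω : ℕ → G) :
    ∑ i ∈ Finset.range n, (if walk ω i = 1 ∧ visits i ω < k then 1 else 0) =
      min (visits n ω) k := by
  induction n with
  | zero => simp
  | succ n ih =>
    rw [Finset.sum_range_succ, ih, visits_succ]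
    by_cases h1 : walk ω n = 1 <;> by_cases h2 : visits n ω < k <;> simp [h1, h2] <;> omega

open Classical in
lemma exitCount_eq (hT : T ≤ n) (h : visits T ω = k) :
    exitCount k n x ω = ∑ i ∈ Finset.range T, if walk ω i = 1 ∧ ω i = x then 1 else 0 := by
  rw [exitCount]
  symm
  rw [← Finset.sum_subset (Finset.range_mono hT)]
  · refine Finset.sum_congr rfl fun i hi => ?_
    refine if_congr ?_ rfl rfl
    constructor
    · rintro ⟨h1, h2⟩
      exact ⟨⟨h1, h ▸ visits_lt h1 (Finset.mem_range.1 hi)⟩, h2⟩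
    · rintro ⟨⟨h1, -⟩, h2⟩
      exact ⟨h1, h2⟩
  · intro i _ hi
    refine if_neg fun h' => ?_
    have := visits_mono ω (not_lt.1 (Finset.mem_range.not.1 hi))
    simp only at this
    omega

lemma exitDeviation_eq (m : ℝ) (hT : T ≤ n) (h : visits T ω = k) :
    exitDeviation m k n x ω = exitCount k n x ω - k * m := by
  classical
  have h1 : min (visits n ω) k = k := min_eq_right (h ▸ visits_mono ω hT)
  rw [← sum_early_visits] at h1
  have h2 : (k : ℝ) =
      ∑ i ∈ Finset.range n, if walk ω i = 1 ∧ visits i ω < k then (1 : ℝ) else 0 := by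
    conv_lhs => rw [← h1]
    push_cast
    rfl
  rw [h2, exitDeviation, exitCount, Finset.sum_mul]
  push_cast
  rw [← Finset.sum_sub_distrib]
  refine Finset.sum_congr rfl fun i _ => ?_
  by_cases ha : walk ω i = 1 ∧ visits i ω < k <;> by_cases hb : ω i = x <;> simp [ha, hb]

lemma exitDeviation_congr (m : ℝ) {ω' : ℕ → G} (h : ∀ i < n, ω i = ω' i) :
    exitDeviation m k n x ω = exitDeviation m k n x ω' := by
  refine Finset.sum_congr rfl fun i hi => ?_
  have hi := Finset.mem_range.1 hi
  rw [walk_congr fun j hj => h j (hj.trans hi), visits_congr fun j hj => h j (hj.trans hi), h i hi]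

end Counting

section SecondMoment

variable {G : Type*} [Group G] [Countable G] [MeasurableSpace G] [MeasurableSingletonClass G]
  {μ : Measure G} [IsProbabilityMeasure μ]

lemma integrable_of_dependsOn {f : (ℕ → G) → ℝ} {s : Finset ℕ} (hf : DependsOn f s) {C : ℝ}
    (hC : ∀ ω, |f ω| ≤ C) : Integrable f (pathMeasure μ) :=
  Integrable.of_bound (measurable_of_dependsOn hf).aestronglyMeasurable C (ae_of_all _ hC)

/-- The martingale differences are orthogonal, and at most `k` of them are nonzero. -/
lemma integral_exitDeviation_sq_le (k n : ℕ) (x : G) :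
    Integrable (fun ω => exitDeviation (μ.real {x}) k n x ω ^ 2) (pathMeasure μ) ∧
    ∫ ω, exitDeviation (μ.real {x}) k n x ω ^ 2 ∂(pathMeasure μ) ≤ k := by
  classical
  set m := μ.real {x} with hm
  have hm0 : 0 ≤ m := measureReal_nonneg
  have hm1 : m ≤ 1 := measureReal_le_one
  let I : ℕ → (ℕ → G) → ℝ := fun i ω => if walk ω i = 1 ∧ visits i ω < k then 1 else 0
  let ξ : G → ℝ := fun g => (if g = x then 1 else 0) - m
  have hξ : ∀ g, |ξ g| ≤ 1 := by
    intro g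
    simp only [ξ]
    split_ifs <;> rw [abs_le] <;> constructor <;> linarith
  have hI : ∀ i ω, 0 ≤ I i ω ∧ I i ω ≤ 1 ∧ I i ω ^ 2 = I i ω := by
    intro i ω
    simp only [I]
    split_ifs <;> norm_num
  have hM : ∀ n ω, |exitDeviation m k n x ω| ≤ n := by
    intro n ω
    refine (Finset.abs_sum_le_sum_abs _ _).trans ?_
    refine (Finset.sum_le_card_nsmul _ _ 1 fun i _ => ?_).trans (by simp)
    rw [abs_mul]
    refine mul_le_one₀ ?_ (abs_nonneg _) (hξ (ω i))
    rw [abs_of_nonneg (hI i ω).1]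
    exact (hI i ω).2.1
  have hIdep : ∀ i n, i ≤ n → DependsOn (I i) (Finset.range n : Finset ℕ) := by
    intro i n hin ω ω' h
    have h' : ∀ j < i, ω j = ω' j := fun j hj => h j (by simp; omega)
    simp only [I]
    rw [walk_congr h', visits_congr h']
  have hMdep : ∀ n, DependsOn (exitDeviation m k n x) (Finset.range n : Finset ℕ) :=
    fun n ω ω' h => exitDeviation_congr m fun i hi => h i (by simpa using hi)
  have hMsq : ∀ n, Integrable (fun ω => exitDeviation m k n x ω ^ 2) (pathMeasure μ) := by
    intro n
    refine integrable_of_dependsOn (s := Finset.range n) (C := (n : ℝ) ^ 2)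
      (fun ω ω' h => by rw [hMdep n h]) fun ω => ?_
    rw [abs_pow]
    exact pow_le_pow_left₀ (abs_nonneg _) (hM n ω) 2
  have hIint : ∀ i, Integrable (I i) (pathMeasure μ) := fun i =>
    integrable_of_dependsOn (hIdep i i le_rfl) (C := 1) fun ω => by
      rw [abs_of_nonneg (hI i ω).1]; exact (hI i ω).2.1
  have hξint : Integrable (fun ω : ℕ → G => ξ (ω n)) (pathMeasure μ) := by
    refine integrable_of_dependsOn (s := {n}) (C := 1) (fun ω ω' h => ?_) fun ω => hξ _
    rw [h n (by simp)]
  have hξ0 : ∀ n, ∫ ω : ℕ → G, ξ (ω n) ∂(pathMeasure μ) = 0 := by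
    intro n
    have h1 : (fun ω : ℕ → G => ξ (ω n)) =
        fun ω => {ω : ℕ → G | ω n = x}.indicator (fun _ => (1 : ℝ)) ω - m := by
      ext ω
      simp [ξ, Set.indicator]
    rw [h1, integral_sub ((integrable_const _).indicator (measurableSet_coord n x))
      (integrable_const _), integral_indicator_const _ (measurableSet_coord n x), measureReal_def,
      pathMeasure_coord]
    simp [hm, measureReal_def]
  refine ⟨hMsq n, ?_⟩
  have key : ∫ ω, exitDeviation m k n x ω ^ 2 ∂(pathMeasure μ) ≤
      ∑ i ∈ Finset.range n, ∫ ω, I i ω ∂(pathMeasure μ) := by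
    clear hξint
    induction n with
    | zero => simp [exitDeviation]
    | succ n ih =>
      have hdep : DependsOn (fun ω => exitDeviation m k n x ω * I n ω)
          (Finset.range n : Finset ℕ) := fun ω ω' h => by
        simp only
        rw [hMdep n h, hIdep n n le_rfl h]
      have hcross : ∫ ω, exitDeviation m k n x ω * I n ω * ξ (ω n) ∂(pathMeasure μ) = 0 := by
        have hind := (indepFun_of_dependsOn (μ := μ) hdep (i := n) (by simp)).comp
          measurable_id (measurable_of_countable ξ)
        have := hind.integral_fun_mul_eq_mul_integral
          (measurable_of_dependsOn hdep).aestronglyMeasurable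
          ((measurable_of_countable ξ).comp (measurable_pi_apply n)).aestronglyMeasurable
        simp only [Function.comp_apply, id_eq] at this
        rw [this, hξ0, mul_zero]
      have hcint : Integrable (fun ω => exitDeviation m k n x ω * I n ω * ξ (ω n))
          (pathMeasure μ) := by
        refine integrable_of_dependsOn (s := Finset.range (n + 1)) (C := n) (fun ω ω' h => ?_)
          fun ω => ?_
        · have h' : ∀ i ∈ (Finset.range n : Set ℕ), ω i = ω' i := fun i hi => h i (by
            simp only [Finset.coe_range, Set.mem_Iio] at hi ⊢; omega)
          have := hdep h'
          simp only at this ⊢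
          rw [this, h n (by simp)]
        · rw [abs_mul, abs_mul, abs_of_nonneg (hI n ω).1]
          calc _ ≤ (n : ℝ) * 1 * 1 := by
                gcongr
                · exact hM n ω
                · exact (hI n ω).2.1
                · exact hξ _
            _ = n := by ring
      have hpt : ∀ ω, exitDeviation m k (n + 1) x ω ^ 2 ≤ exitDeviation m k n x ω ^ 2 +
          2 * (exitDeviation m k n x ω * I n ω * ξ (ω n)) + I n ω := by
        intro ω
        have e : exitDeviation m k (n + 1) x ω = exitDeviation m k n x ω + I n ω * ξ (ω n) :=
          Finset.sum_range_succ _ _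
        have h1 : ξ (ω n) ^ 2 ≤ 1 := (sq_le_one_iff_abs_le_one _).2 (hξ _)
        have h2 := (hI n ω).2.2
        have h3 := mul_le_mul_of_nonneg_left h1 (hI n ω).1
        rw [e, add_sq, mul_pow, h2]
        linarith
      rw [Finset.sum_range_succ]
      refine (integral_mono (hMsq (n + 1)) (((hMsq n).add (hcint.const_mul 2)).add (hIint n))
        hpt).trans ?_
      rw [integral_add' ((hMsq n).add (hcint.const_mul 2)) (hIint n),
        integral_add' (hMsq n) (hcint.const_mul 2), integral_const_mul, hcross]
      linarith
  refine key.trans ?_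
  rw [← integral_finsetSum _ fun i _ => hIint i]
  have hk : ∀ ω : ℕ → G, ∑ i ∈ Finset.range n, I i ω ≤ k := by
    intro ω
    have := sum_early_visits k n ω
    have h2 : ∑ i ∈ Finset.range n, I i ω = ((min (visits n ω) k : ℕ) : ℝ) := by
      rw [← this]; push_cast; rfl
    rw [h2]
    exact_mod_cast min_le_right _ _
  refine (integral_mono (integrable_finsetSum _ fun i _ => hIint i) (integrable_const (k : ℝ))
    hk).trans ?_
  simp

lemma lintegral_exitDeviation_le {r : ℕ} (hr : 0 < r) (n : ℕ) (x : G) :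
    ∫⁻ ω, ‖exitDeviation (μ.real {x}) (r ^ 2) n x ω‖ₑ ∂(pathMeasure μ) ≤ 2 * r := by
  obtain ⟨hint, hle⟩ := integral_exitDeviation_sq_le (μ := μ) (r ^ 2) n x
  set M := exitDeviation (μ.real {x}) (r ^ 2) n x
  have hr' : (0 : ℝ) < r := by exact_mod_cast hr
  have hpt : ∀ ω, ‖M ω‖ₑ ≤ ENNReal.ofReal (r + M ω ^ 2 / r) := by
    intro ω
    rw [← ofReal_norm, Real.norm_eq_abs]
    refine ENNReal.ofReal_le_ofReal ?_
    -- `|M| ≤ r + M² / r`, balanced for a second moment of size `r ^ 2`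
    rw [← sub_le_iff_le_add', le_div_iff₀ hr', ← sq_abs]
    nlinarith [sq_nonneg (|M ω| - r), abs_nonneg (M ω)]
  refine (lintegral_mono hpt).trans ?_
  have hsum : Integrable (fun ω => (r : ℝ) + M ω ^ 2 / r) (pathMeasure μ) :=
    (integrable_const _).add (hint.div_const _)
  rw [← ofReal_integral_eq_lintegral_ofReal hsum
    (ae_of_all _ fun ω => by positivity), integral_add (integrable_const _) (hint.div_const _),
    integral_div]
  have : ENNReal.ofReal (2 * r) = 2 * r := by
    rw [ENNReal.ofReal_mul zero_le_two]; simp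
  rw [← this]
  refine ENNReal.ofReal_le_ofReal ?_
  have h2 : (∫ ω, M ω ^ 2 ∂(pathMeasure μ)) / r ≤ r := by
    rw [div_le_iff₀ hr']
    push_cast at hle
    nlinarith
  simp
  linarith

end SecondMoment

/-! ### The recurrent case -/

/-- Continuity of `t ↦ -t log t` as a one-sided estimate with an error linear in the distance. -/
lemma exists_negMulLog_le {t ε : ℝ} (ht0 : 0 ≤ t) (ht1 : t ≤ 1) (hε : 0 < ε) :
    ∃ C : ℝ, 0 ≤ C ∧ ∀ s, 0 ≤ s → s ≤ 1 →
      Real.negMulLog t ≤ Real.negMulLog s + ε + C * |s - t| := by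
  obtain ⟨δ, hδ, h⟩ :=
    Metric.continuousAt_iff.1 (Real.continuous_negMulLog.continuousAt (x := t)) ε hε
  have hφ := Real.negMulLog_nonneg ht0 ht1
  refine ⟨Real.negMulLog t / δ, by positivity, fun s hs0 hs1 => ?_⟩
  have hs := Real.negMulLog_nonneg hs0 hs1
  by_cases hd : |s - t| < δ
  · have := h (x := s) (by rwa [Real.dist_eq])
    rw [Real.dist_eq, abs_lt] at this
    have : 0 ≤ Real.negMulLog t / δ * |s - t| := by positivity
    linarith
  · have : Real.negMulLog t ≤ Real.negMulLog t / δ * |s - t| := by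
      rw [div_mul_eq_mul_div, le_div_iff₀ hδ]
      exact mul_le_mul_of_nonneg_left (not_lt.1 hd) hφ
    linarith

/-- The two hypotheses `h1` and `h2` say that `|k a - k m b| ≤ J`: the conditional probability
`a / b` is close to `m`, and so `b φ(a / b)` is not much smaller than `b φ(m)`. -/
lemma eta_mul_le_condTerm {m a b J : ℝ≥0∞} {k : ℕ} {ε C : ℝ} (hk : 0 < k) (hε : 0 ≤ ε) (hC : 0 ≤ C)
    (hm : m ≤ 1) (hab : a ≤ b) (hb : b ≤ 1) (hJ : J ≠ ∞)
    (hCs : ∀ s, 0 ≤ s → s ≤ 1 →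
      Real.negMulLog m.toReal ≤ Real.negMulLog s + ε + C * |s - m.toReal|)
    (h1 : k * a ≤ k * m * b + J) (h2 : k * m * b ≤ k * a + J) :
    eta m * b ≤ condTerm a b + ENNReal.ofReal ε * b + ENNReal.ofReal (C / k) * J := by
  have hbt : b ≠ ∞ := ne_top_of_le_ne_top ENNReal.one_ne_top hb
  have hat : a ≠ ∞ := ne_top_of_le_ne_top hbt hab
  have hmt : m ≠ ∞ := ne_top_of_le_ne_top ENNReal.one_ne_top hm
  lift a to ℝ≥0 using hat
  lift b to ℝ≥0 using hbt
  lift m to ℝ≥0 using hmt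
  lift J to ℝ≥0 using hJ
  have hk' : (0 : ℝ) < k := by exact_mod_cast hk
  have h1' : (k : ℝ) * a ≤ k * m * b + J := by exact_mod_cast h1
  have h2' : (k : ℝ) * m * b ≤ k * a + J := by exact_mod_cast h2
  have hab' : (a : ℝ) ≤ b := by exact_mod_cast hab
  have hm1 : (m : ℝ) ≤ 1 := by exact_mod_cast hm
  have hq0 : (0 : ℝ) ≤ a / b := by positivity
  have hq1 : (a : ℝ) / b ≤ 1 := div_le_one_of_le₀ hab' b.coe_nonneg
  have hφ := Real.negMulLog_nonneg hq0 hq1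
  have hφm := Real.negMulLog_nonneg m.coe_nonneg hm1
  have key : Real.negMulLog m * b ≤ b * Real.negMulLog (a / b) + ε * b + C / k * J := by
    have h3 : (b : ℝ) * |(a : ℝ) / b - m| ≤ J / k := by
      rcases eq_or_ne b 0 with rfl | hb0
      · simp; positivity
      have hb0 : (0 : ℝ) < b := by positivity
      rw [← abs_of_pos hb0, ← abs_mul, abs_of_pos hb0, mul_sub, mul_div_cancel₀ _ hb0.ne',
        abs_sub_le_iff, le_div_iff₀ hk', le_div_iff₀ hk']
      constructor <;> linarith
    have h4 := mul_le_mul_of_nonneg_right (hCs _ hq0 hq1) b.coe_nonneg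
    have h5 := mul_le_mul_of_nonneg_left h3 hC
    rw [show C / k * (J : ℝ) = C * (J / k) by ring]
    simp only [ENNReal.coe_toReal] at h4
    linarith
  have := ENNReal.ofReal_le_ofReal key
  rw [ENNReal.ofReal_mul hφm, ENNReal.ofReal_add (by positivity) (by positivity),
    ENNReal.ofReal_add (by positivity) (by positivity), ENNReal.ofReal_mul hε,
    ENNReal.ofReal_mul (p := C / k) (by positivity)] at this
  simpa [eta, condTerm] using this

section Recurrent

variable {G : Type*} [Group G]

/-- The event that the walk has returned to the identity at least `k` times up to time `n`. -/
def hasReturned (k n : ℕ) : Set (ℕ → G) := {ω | ∃ T ≤ n, walk ω T = 1 ∧ visits T ω = k}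

lemma hasReturned_inter_eq (k n : ℕ) (w : Multiset (G × G)) :
    hasReturned k n ∩ {ω | edgeMultiset n ω = w} =
      ⋃ T ∈ Finset.range (n + 1), kthReturn k T n w := by
  ext ω
  simp only [hasReturned, kthReturn, Set.mem_inter_iff, Set.mem_ofPred_eq, Set.mem_iUnion,
    Finset.mem_range, Nat.lt_succ_iff, exists_prop]
  constructor
  · rintro ⟨⟨T, h1, h2, h3⟩, h4⟩; exact ⟨T, h1, h2, h3, h4⟩
  · rintro ⟨T, h1, h2, h3, h4⟩; exact ⟨⟨T, h1, h2, h3⟩, h4⟩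

lemma disjoint_kthReturn {k n T T' : ℕ} (w : Multiset (G × G)) (h : T ≠ T') :
    Disjoint (kthReturn k T n w) (kthReturn k T' n w) := by
  rw [Set.disjoint_left]
  rintro ω ⟨h1, h2, -⟩ ⟨h1', h2', -⟩
  rcases lt_or_gt_of_ne h with h | h
  · have := visits_lt h1 h; omega
  · have := visits_lt h1' h; omega

lemma exists_visits_eq {ω : ℕ → G} (h : ∀ m, ∃ n, 1 ≤ n ∧ walk ω (m + n) = walk ω m) (k : ℕ) :
    ∃ T, walk ω T = 1 ∧ visits T ω = k := by
  classical
  induction k with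
  | zero => exact ⟨0, rfl, rfl⟩
  | succ k ih =>
    obtain ⟨T, h1, h2⟩ := ih
    have hex := h T
    obtain ⟨hn1, hn2⟩ := Nat.find_spec hex
    have hmin : ∀ j, j < Nat.find hex → visits (T + 1 + j) ω = k + 1 := by
      intro j hj
      induction j with
      | zero => rw [add_zero, visits_succ, h2, if_pos h1]
      | succ j ih =>
        rw [← add_assoc, visits_succ, ih (by omega), if_neg]
        intro hc
        refine Nat.find_min hex hj ⟨by omega, ?_⟩
        rw [h1, ← hc]
        congr 1
        omega
    refine ⟨T + Nat.find hex, hn2.trans h1, ?_⟩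
    have := hmin (Nat.find hex - 1) (by omega)
    rwa [show T + 1 + (Nat.find hex - 1) = T + Nat.find hex by omega] at this

/-- By stationarity of the increments, a recurrent walk returns almost surely to each of its
positions, and hence infinitely often to the identity. -/
lemma tendsto_measure_hasReturned [MeasurableSpace G] {μ : Measure G} [IsProbabilityMeasure μ]
    (hrec : IsRecurrent μ) (k : ℕ) :
    Tendsto (fun n => pathMeasure μ (hasReturned (G := G) k n)) atTop (𝓝 1) := by
  have h1 : ∀ m, ∀ᵐ ω ∂(pathMeasure μ), ∃ n, 1 ≤ n ∧ walk ω (m + n) = walk ω m := by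
    intro m
    have := (measurePreserving_reindex (μ := μ)
      (add_left_injective m)).quasiMeasurePreserving.ae hrec
    filter_upwards [this] with ω ⟨n, hn, h⟩
    exact ⟨n, hn, by rw [walk_add, h, mul_one]⟩
  have h2 : pathMeasure μ (⋃ n, hasReturned (G := G) k n) = 1 := by
    rw [← measure_univ (μ := pathMeasure μ)]
    refine measure_congr (eventuallyEq_univ.2 ?_)
    filter_upwards [ae_all_iff.2 h1] with ω hω
    obtain ⟨T, hT⟩ := exists_visits_eq hω k
    exact Set.mem_iUnion.2 ⟨T, T, le_rfl, hT⟩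
  rw [← h2]
  refine tendsto_measure_iUnion_atTop fun n n' hn ω => ?_
  rintro ⟨T, hT, h⟩
  exact ⟨T, hT.trans hn, h⟩

variable [Countable G] [MeasurableSpace G] [MeasurableSingletonClass G]
  {μ : Measure G} [IsProbabilityMeasure μ]

/-- On the event that the `k`-th return happens at time `T`, the first step has the law of the
step taken at a uniformly chosen one of the first `k` visits. -/
lemma natCast_mul_measure_kthReturn {k T n : ℕ} (hT : T ≤ n) (x : G) (w : Multiset (G × G)) :
    k * pathMeasure μ (kthReturn k T n w ∩ {ω | ω 0 = x}) =
      ∫⁻ ω in kthReturn k T n w, (exitCount k n x ω : ℝ≥0∞) ∂(pathMeasure μ) := by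
  classical
  have hA := measurableSet_kthReturn (k := k) hT w
  have h1 : ∫⁻ ω in kthReturn k T n w, (exitCount k n x ω : ℝ≥0∞) ∂(pathMeasure μ) =
      ∑ s ∈ Finset.range T,
        pathMeasure μ (kthReturn k T n w ∩ {ω | walk ω s = 1 ∧ ω s = x}) := by
    rw [sum_measure_inter (p := fun s ω => walk ω s = 1 ∧ ω s = x) _ _
      fun i => (measurableSet_walk i 1).inter (measurableSet_coord i x)]
    refine setLIntegral_congr_fun hA fun ω hω => ?_
    rw [exitCount_eq hT hω.2.1]
    congr!
  have h2 : ∑ s ∈ Finset.range T,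
        pathMeasure μ (kthReturn k T n w ∩ {ω | walk ω s = 1 ∧ ω s = x}) =
      ∑ s ∈ Finset.range T,
        pathMeasure μ (kthReturn k T n w ∩ {ω | ω 0 = x} ∩ {ω | walk ω (s + 1) = 1}) := by
    -- the reflection `s ↦ T - s` turns visits during `[0, T)` into visits during `(0, T]`
    rw [← Finset.sum_range_reflect (fun s =>
      pathMeasure μ (kthReturn k T n w ∩ {ω | ω 0 = x} ∩ {ω | walk ω (s + 1) = 1}))]
    refine Finset.sum_congr rfl fun s hs => ?_
    have hs := Finset.mem_range.1 hs
    rw [measure_rotateBlock hs hT, show T - 1 - s + 1 = T - s by omega]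
    congr 1
    ext ω
    simp only [Set.mem_inter_iff, Set.mem_ofPred_eq]
    tauto
  rw [h1, h2, sum_measure_inter _ _ fun i => measurableSet_walk (i + 1) 1]
  rw [← setLIntegral_const]
  refine setLIntegral_congr_fun (hA.inter (measurableSet_coord 0 x)) fun ω hω => ?_
  obtain ⟨⟨h3, h4, -⟩, -⟩ := hω
  have h5 := Finset.sum_range_succ' (fun i => if walk ω i = 1 then 1 else 0) T
  have h6 := visits_succ T ω
  rw [if_pos h3, h4, visits, h5] at h6
  simp only [walk_zero, if_true, add_left_inj] at h6
  rw [← h6]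

lemma natCast_mul_measure_hasReturned (k n : ℕ) (x : G) (w : Multiset (G × G)) :
    k * pathMeasure μ ((hasReturned k n ∩ {ω | edgeMultiset n ω = w}) ∩ {ω | ω 0 = x}) =
      ∫⁻ ω in hasReturned k n ∩ {ω | edgeMultiset n ω = w},
        (exitCount k n x ω : ℝ≥0∞) ∂(pathMeasure μ) := by
  have hm : ∀ T ∈ Finset.range (n + 1), MeasurableSet (kthReturn (G := G) k T n w) := fun T hT =>
    measurableSet_kthReturn (Nat.lt_succ_iff.1 (Finset.mem_range.1 hT)) w
  rw [hasReturned_inter_eq, Set.iUnion₂_inter, lintegral_biUnion_finset _ hm,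
    measure_biUnion_finset _ fun T hT => (hm T hT).inter (measurableSet_coord 0 x), Finset.mul_sum]
  · exact Finset.sum_congr rfl fun T hT =>
      natCast_mul_measure_kthReturn (Nat.lt_succ_iff.1 (Finset.mem_range.1 hT)) x w
  · exact fun T _ T' _ h =>
      (disjoint_kthReturn w h).mono Set.inter_subset_left Set.inter_subset_left
  · exact fun T _ T' _ h => disjoint_kthReturn w h

lemma measurableSet_hasReturned (k n : ℕ) : MeasurableSet (hasReturned (G := G) k n) := by
  have : hasReturned (G := G) k n = ⋃ w, hasReturned k n ∩ {ω | edgeMultiset n ω = w} := by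
    ext; simp
  rw [this]
  refine MeasurableSet.iUnion fun w => ?_
  rw [hasReturned_inter_eq]
  exact Finset.measurableSet_biUnion _ fun T hT =>
    measurableSet_kthReturn (Nat.lt_succ_iff.1 (Finset.mem_range.1 hT)) w

/-- The quantitative form of the recurrent case, with `k = r ^ 2` returns: on the event that
they have happened, the conditional probability of a first step `x` is close to `μ {x}` in `L¹`. -/
lemma eta_mul_measure_hasReturned_le {ε C : ℝ} (hε : 0 ≤ ε) (hC : 0 ≤ C) {x : G}
    (hCs : ∀ s, 0 ≤ s → s ≤ 1 →
      Real.negMulLog (μ {x}).toReal ≤ Real.negMulLog s + ε + C * |s - (μ {x}).toReal|)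
    {r : ℕ} (hr : 0 < r) (n : ℕ) :
    eta (μ {x}) * pathMeasure μ (hasReturned (G := G) (r ^ 2) n) ≤
      eventCondEntropy (pathMeasure μ) {ω | ω 0 = x} (edgeMultiset (G := G) n) +
        ENNReal.ofReal ε + ENNReal.ofReal (2 * C / r) := by
  set P := pathMeasure μ with hP
  set N := hasReturned (G := G) (r ^ 2) n
  have hN : MeasurableSet N := measurableSet_hasReturned _ _
  set M := exitDeviation (μ.real {x}) (r ^ 2) n x
  have hMle : ∫⁻ ω, ‖M ω‖ₑ ∂P ≤ 2 * r := lintegral_exitDeviation_le hr n x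
  have hY := measurableSet_edgeMultiset (G := G) n
  let J : Multiset (G × G) → ℝ≥0∞ := fun w =>
    ∫⁻ ω in N ∩ {ω | edgeMultiset n ω = w}, ‖M ω‖ₑ ∂P
  have hpt : ∀ w, eta (μ {x}) * P (N ∩ {ω | edgeMultiset n ω = w}) ≤
      condTerm (P ((N ∩ {ω | edgeMultiset n ω = w}) ∩ {ω | ω 0 = x}))
        (P (N ∩ {ω | edgeMultiset n ω = w})) +
      ENNReal.ofReal ε * P (N ∩ {ω | edgeMultiset n ω = w}) +
      ENNReal.ofReal (C / (r ^ 2 : ℕ)) * J w := by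
    intro w
    have hA : MeasurableSet (N ∩ {ω | edgeMultiset n ω = w}) := hN.inter (hY w)
    have hdev : ∀ ω ∈ N, M ω = exitCount (r ^ 2) n x ω - (r ^ 2 : ℕ) * μ.real {x} := by
      rintro ω ⟨T, hT, -, h⟩
      exact exitDeviation_eq _ hT h
    have hconst : ((r ^ 2 : ℕ) : ℝ≥0∞) * μ {x} =
        ENNReal.ofReal ((r ^ 2 : ℕ) * μ.real {x}) := by
      rw [ENNReal.ofReal_mul (by positivity), ENNReal.ofReal_natCast, measureReal_def,
        ENNReal.ofReal_toReal (measure_ne_top _ _)]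
    refine eta_mul_le_condTerm (by positivity) hε hC prob_le_one
      (measure_mono Set.inter_subset_left) prob_le_one ?_ hCs ?_ ?_
    · refine ne_top_of_le_ne_top (b := 2 * (r : ℝ≥0∞)) ?_
        ((setLIntegral_le_lintegral _ _).trans hMle)
      exact ENNReal.mul_ne_top (by simp) (by simp)
    · rw [natCast_mul_measure_hasReturned, ← setLIntegral_const,
        ← lintegral_add_left measurable_const]
      refine setLIntegral_mono' hA fun ω hω => ?_
      rw [hconst, ← ofReal_norm, ← ENNReal.ofReal_add (by positivity) (norm_nonneg _),
        ← ENNReal.ofReal_natCast, hdev ω hω.1]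
      refine ENNReal.ofReal_le_ofReal ?_
      have := Real.le_norm_self ((exitCount (r ^ 2) n x ω : ℝ) - (r ^ 2 : ℕ) * μ.real {x})
      linarith
    · have hcm : Measurable fun ω : ℕ → G => (exitCount (r ^ 2) n x ω : ℝ≥0∞) := by
        refine measurable_of_dependsOn (s := Finset.range n) fun ω ω' h => ?_
        have h' : ∀ i < n, ω i = ω' i := fun i hi => h i (by simpa using hi)
        congr 1
        refine Finset.sum_congr rfl fun i hi => ?_
        have hi := Finset.mem_range.1 hi
        rw [walk_congr fun j hj => h' j (hj.trans hi),
          visits_congr fun j hj => h' j (hj.trans hi), h' i hi]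
      rw [natCast_mul_measure_hasReturned, ← setLIntegral_const, ← lintegral_add_left hcm]
      refine setLIntegral_mono' hA fun ω hω => ?_
      rw [hconst, ← ofReal_norm, ← ENNReal.ofReal_natCast, ← ENNReal.ofReal_add (by positivity)
        (norm_nonneg _), hdev ω hω.1]
      refine ENNReal.ofReal_le_ofReal ?_
      have := neg_le_of_abs_le (le_refl |(exitCount (r ^ 2) n x ω : ℝ) - (r ^ 2 : ℕ) * μ.real {x}|)
      rw [Real.norm_eq_abs]
      linarith
  have hsumP : ∑' w, P (N ∩ {ω | edgeMultiset n ω = w}) = P N := tsum_measure_inter_fiber hY N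
  have hsumJ : ∑' w, J w ≤ 2 * r := by
    have h := tsum_measure_inter_fiber (P := P.withDensity fun ω => ‖M ω‖ₑ) hY N
    rw [withDensity_apply _ hN,
      tsum_congr fun w => withDensity_apply _ (hN.inter (hY w))] at h
    rw [h]
    exact (setLIntegral_le_lintegral _ _).trans hMle
  calc eta (μ {x}) * P N = ∑' w, eta (μ {x}) * P (N ∩ {ω | edgeMultiset n ω = w}) := by
        rw [ENNReal.tsum_mul_left, hsumP]
    _ ≤ ∑' w, (condTerm (P ((N ∩ {ω | edgeMultiset n ω = w}) ∩ {ω | ω 0 = x}))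
        (P (N ∩ {ω | edgeMultiset n ω = w})) +
      ENNReal.ofReal ε * P (N ∩ {ω | edgeMultiset n ω = w}) +
      ENNReal.ofReal (C / (r ^ 2 : ℕ)) * J w) := ENNReal.tsum_le_tsum hpt
    _ = ∑' w, condTerm (P ((N ∩ {ω | edgeMultiset n ω = w}) ∩ {ω | ω 0 = x}))
        (P (N ∩ {ω | edgeMultiset n ω = w})) + ENNReal.ofReal ε * P N +
        ENNReal.ofReal (C / (r ^ 2 : ℕ)) * ∑' w, J w := by
        rw [ENNReal.tsum_add, ENNReal.tsum_add, ENNReal.tsum_mul_left, ENNReal.tsum_mul_left, hsumP]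
    _ ≤ _ := by
        gcongr
        · exact tsum_condTerm_inter_le _ hN _
        · exact mul_le_of_le_one_right' prob_le_one
        · refine (mul_le_mul_right hsumJ _).trans_eq ?_
          have h2 : (2 * r : ℝ≥0∞) = ENNReal.ofReal (2 * r) := by
            rw [ENNReal.ofReal_mul zero_le_two]; simp
          rw [h2, ← ENNReal.ofReal_mul (by positivity)]
          congr 1
          have : (r : ℝ) ≠ 0 := by positivity
          push_cast
          field_simp

/-- For a recurrent walk the information that the path carries on the first step vanishes in the
limit. -/
lemma entropy_le_iSup_condEntropy (hrec : IsRecurrent μ) :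
    entropy (pathMeasure μ) (fun ω : ℕ → G => ω 0) ≤
      ⨆ n, condEntropy (pathMeasure μ) (fun ω => ω 0) (edgeMultiset (G := G) (n + 1)) := by
  set f : G → ℕ → ℝ≥0∞ := fun x n =>
    eventCondEntropy (pathMeasure μ) {ω | ω 0 = x} (edgeMultiset (G := G) (n + 1)) with hf
  have hmono : ∀ x, Monotone (f x) := fun x =>
    monotone_nat_of_le_succ fun n => eventCondEntropy_edgeMultiset_le_succ (by omega) x
  have hx : ∀ x, eta (μ {x}) ≤ ⨆ n, f x n := by
    intro x
    refine ENNReal.le_of_forall_pos_le_add fun δ hδ _ => ?_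
    have hδ' : (0 : ℝ) < δ := by exact_mod_cast hδ
    obtain ⟨C, hC, hCs⟩ := exists_negMulLog_le (t := (μ {x}).toReal) (ε := δ / 2)
      ENNReal.toReal_nonneg measureReal_le_one (by positivity)
    obtain ⟨r, hr⟩ := exists_nat_gt (max 0 (4 * C / δ))
    have hr0 : 0 < r := by
      have := (le_max_left _ _).trans_lt hr
      exact_mod_cast this
    have hr0' : (0 : ℝ) < r := by exact_mod_cast hr0
    have hr1 : 2 * C / r ≤ δ / 2 := by
      have := (le_max_right _ _).trans_lt hr
      rw [div_lt_iff₀ hδ'] at this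
      rw [div_le_iff₀ hr0']
      linarith
    have hlim := ENNReal.Tendsto.const_mul
      ((tendsto_measure_hasReturned hrec (r ^ 2)).comp (tendsto_add_atTop_nat 1))
      (a := eta (μ {x})) (Or.inl one_ne_zero)
    rw [mul_one] at hlim
    refine le_of_tendsto' hlim fun n => ?_
    refine (eta_mul_measure_hasReturned_le (by positivity) hC hCs hr0 (n + 1)).trans ?_
    rw [add_assoc, ← ENNReal.ofReal_add (by positivity) (by positivity)]
    gcongr
    · exact le_iSup (f x) n
    · rw [← ENNReal.ofReal_coe_nnreal]
      exact ENNReal.ofReal_le_ofReal (by linarith)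
  have hlim : ∀ s : Finset G, ∑ x ∈ s, eta (μ {x}) ≤
      ⨆ n, condEntropy (pathMeasure μ) (fun ω => ω 0) (edgeMultiset (G := G) (n + 1)) := by
    intro s
    refine (Finset.sum_le_sum fun x _ => hx x).trans ?_
    rw [ENNReal.finsetSum_iSup_of_monotone hmono]
    exact iSup_mono fun n => ENNReal.sum_le_tsum s
  rw [entropy_eq]
  simp_rw [pathMeasure_coord]
  rw [ENNReal.tsum_eq_iSup_sum]
  exact iSup_le hlim

end Recurrent
end RandomWalkTrace

theorem theorem1p3 {G : Type*} [Group G] [Countable G] [MeasurableSpace G]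
    [MeasurableSingletonClass G] (μ : Measure G) [IsProbabilityMeasure μ]
    (hgen : Subgroup.closure {g : G | 0 < μ {g}} = ⊤)
    (hpos : 0 < RandomWalkTrace.entropy (RandomWalkTrace.pathMeasure μ)
      (RandomWalkTrace.increment (G := G) 1))
    (hfin : RandomWalkTrace.entropy (RandomWalkTrace.pathMeasure μ)
      (RandomWalkTrace.increment (G := G) 1) < ∞) :
    ∃ h : ℝ≥0,
      Tendsto (fun n : ℕ => RandomWalkTrace.entropy (RandomWalkTrace.pathMeasure μ)
        (RandomWalkTrace.trace (G := G) n) / (n : ℝ≥0∞)) atTop (𝓝 (h : ℝ≥0∞)) ∧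
      (RandomWalkTrace.IsRecurrent μ ↔ h = 0) := by
  open RandomWalkTrace in
  have hX : increment (G := G) 1 = fun ω => ω 0 := rfl
  rw [hX] at hpos hfin
  set c : ℕ → ℝ≥0∞ := fun n =>
    condEntropy (pathMeasure μ) (fun ω => ω 0) (edgeMultiset (G := G) (n + 1)) with hc
  have hlim := tendsto_div_of_add_eq
    (H := fun n => entropy (pathMeasure μ) (edgeMultiset (G := G) n)) (c := c)
    hfin.ne ?_ ?_ ?_ entropy_edgeMultiset_succ
  · have htop : entropy (pathMeasure μ) (fun ω : ℕ → G => ω 0) - ⨆ n, c n ≠ ∞ :=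
      ne_top_of_le_ne_top hfin.ne tsub_le_self
    refine ⟨(entropy (pathMeasure μ) (fun ω : ℕ → G => ω 0) - ⨆ n, c n).toNNReal, ?_, ?_⟩
    · rw [ENNReal.coe_toNNReal htop]
      convert hlim using 3 with n
      rw [← entropy_comp_injective _ digraphOfMultiset_injective]
      congr 1
      exact funext (trace_eq n)
    · rw [ENNReal.toNNReal_eq_zero_iff, or_iff_left htop, tsub_eq_zero_iff_le]
      refine ⟨entropy_le_iSup_condEntropy, fun h => ?_⟩
      by_contra hr
      exact absurd (exists_iSup_condEntropy_lt hpos.ne' hfin.ne hr) (not_lt.2 h)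
  · have h0 : edgeMultiset (G := G) 0 = fun _ => 0 := rfl
    simp only [h0, entropy_eq]
    refine ENNReal.tsum_eq_zero.2 fun w => ?_
    by_cases hw : 0 = w <;> simp [hw, eta]
  · exact monotone_nat_of_le_succ fun n =>
      ENNReal.tsum_le_tsum fun x => eventCondEntropy_edgeMultiset_le_succ (by omega) x
  · exact fun n => condEntropy_le (measurableSet_edgeMultiset _) _
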